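/- **Conventions.** Graphs are connected and nonempty, may have loops and multiple edges, and need not be finite; each edge $e$ has endpoints $\iota(e),\tau(e)$. A graph of groups $G_\Gamma$ over $\Gamma$ consists of vertex groups $G_v$, edge groups $G_e$ and monomorphisms $\Phi_e^-\colon G_e\to G_{\iota(e)}$, $\Phi_e^+\colon G_e\to G_{\tau(e)}$. Its fundamental group, with respect to a spanning tree $T$ of $\Gamma$, is generated by the $G_v$ and letters $t_e$ subject to $t_e\Phi_e^-(x)t_e^{-1}=\Phi_e^+(x)$ for $x\in G_e$, and $t_e=1$ for $e\in T$. A graph of nonpositively curved cube complexes $X_\Gamma$ over $\Gamma$ consists of connected nonpositively curved cube complexes $X_v$, $X_e$ and locally isometric combinatorial maps $\phi_e^-\colon X_e\to X_{\iota(e)}$, $\phi_e^+\colon X_e\to X_{\tau(e)}$; its total space is the quotient of $\bigsqcup_v X_v\sqcup\bigsqcup_e X_e\times[0,1]$ by $(x,0)\sim\phi_e^-(x)$, $(x,1)\sim\phi_e^+(x)$. A group $G$ (a cube complex $X$) splits as $G_\Gamma$ (as $X_\Gamma$) if it is its fundamental group (its total space). $G_\Gamma$ has *constant vertex groups* if there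 are a group $K$ and isomorphisms $\Psi_v\colon G_v\to K$ with $\Psi_{\iota(e)}\circ\Phi_e^-=\Psi_{\tau(e)}\circ\Phi_e^+$ for all edges $e$; it has *locally constant vertex groups* if there are isomorphisms $\Theta_e\colon G_{\iota(e)}\to G_{\tau(e)}$ with $\Theta_e\circ\Phi_e^-=\Phi_e^+$ for all $e$. Constant and locally constant vertex spaces are defined in the same way, with a connected nonpositively curved cube complex $K$ and with cubical isometries $\psi_v$, $\theta_e$ in place of isomorphisms. Composing the $\Theta_e^{\pm1}$ (the $\theta_e^{\pm1}$) along loops gives a homomorphism $\pi_1(\Gamma,v)\to\operatorname{Aut}(G_v)$ (respectively $\pi_1(\Gamma,v)\to\operatorname{Aut}(X_v)$, the group of combinatorial automorphisms), whose image is the *monodromy group* at $v$. **Lemma.** Let $X$ be a cube complex that splits as a graph of nonpositively curved cube complexes $X_\Gamma$ with locally constant vertex spaces (with given isometries $\theta_e$), and let $G$ be a group that splits as a graph of groups $G_\Gamma$ with locally constant vertex groups (with given isomorphisms $\Theta_e$); the two underlying graphs may be different. 1. If $G_\Gamma$ has trivial monodromy group at some vertex, then $G_\Gamma$ has constant vertex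 groups. If $X_\Gamma$ has trivial monodromy group at some vertex, then $X_\Gamma$ has constant vertex spaces. 2. If $G_\Gamma$ has finite monodromy group at some vertex, then $G$ has a finite-index subgroup $\widehat G$ whose induced splitting has constant vertex groups. That is, $\widehat G$ splits as a graph of groups with constant vertex groups whose Bass–Serre tree is $\widehat G$-equivariantly isomorphic to the Bass–Serre tree of $G_\Gamma$ with the action restricted to $\widehat G$. 3. If all vertex spaces of $X_\Gamma$ are compact, then $X$ has a finite-sheeted cover $\widehat X$ whose induced splitting has constant vertex spaces. That is, $\widehat X$ is the total space of a graph of nonpositively curved cube complexes $\widehat X_{\widehat\Gamma}$ with constant vertex spaces, and the covering map $\widehat X\to X$ is induced by a morphism $\widehat X_{\widehat\Gamma}\to X_\Gamma$: a graph morphism $p\colon\widehat\Gamma\to\Gamma$ together with combinatorial maps $\widehat X_{\hat v}\to X_{p(\hat v)}$ and $\widehat X_{\hat e}\to X_{p(\hat e)}$ that commute with the attaching maps. -/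

import Mathlib

open CategoryTheory
open scoped unitInterval

universe w v u w' v' u'

/-! ### Graphs

The underlying graph of a graph of groups or of a graph of spaces is a quiver `V`: its points are
the vertices, and an arrow `e : a ⟶ b` is an edge with `ι(e) = a` and `τ(e) = b`. Loops and
multiple edges are allowed, and edges may be traversed in both directions. -/

/-- A graph is connected if it is nonempty and any two vertices are joined by an edge path, where
edges may be traversed in both directions. -/
def GraphConnected (V : Type u) [Quiver.{v} V] : Prop :=
  Nonempty V ∧ Quiver.IsStronglyConnected (Quiver.Symmetrify V)

/-- A set `T` of edges, together with all the vertices, is a spanning tree if the resulting graph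
is connected and simply connected: in its fundamental groupoid (edge paths up to cancellation of
backtracking) there is exactly one morphism between any two vertices. -/
def IsSpanningTree {V : Type u} [Quiver.{v} V] (T : WideSubquiver V) : Prop :=
  ∀ a b : Quiver.FreeGroupoid T, Nonempty (Unique (a ⟶ b))

/-- The fundamental group of a graph at a vertex: closed edge paths up to cancellation of
backtracking, that is, the automorphisms of the vertex in the free groupoid on the graph. -/
abbrev GraphPi1 (V : Type u) [Quiver.{v} V] (a : V) : Type (max u v) :=
  Aut ((Quiver.FreeGroupoid.of V).obj a)

/-- Let `θ` assign to each edge `e : a ⟶ b` an isomorphism `F a ≅ F b`. An edge path is sent to the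
composition of the isomorphisms `θ e` (or their inverses, for edges traversed backwards); this is
a functor on the fundamental groupoid of the graph. -/
def edgeTransport {V : Type u} [Quiver.{v} V] {C : Type*} [Category* C] (F : V → C)
    (θ : ∀ ⦃a b : V⦄, (a ⟶ b) → (F a ≅ F b)) : Quiver.FreeGroupoid V ⥤ C :=
  Quiver.FreeGroupoid.lift
    { obj := fun a => Core.mk (F a)
      map := fun e => CoreHom.mk (θ e) : V ⥤q Core C } ⋙ Core.inclusion C

/-- The homomorphism `π₁(Γ, a) → Aut (F a)` given by transport around loops. -/
def monodromyHom {V : Type u} [Quiver.{v} V] {C : Type*} [Category* C] (F : V → C)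
    (θ : ∀ ⦃a b : V⦄, (a ⟶ b) → (F a ≅ F b)) (a : V) : GraphPi1 V a →* Aut (F a) :=
  (edgeTransport F θ).mapAut ((Quiver.FreeGroupoid.of V).obj a)

/-! ### Graphs of groups -/

/-- A graph of groups over the connected graph `V`. -/
structure GraphOfGroups (V : Type u) [Quiver.{v} V] where
  connected : GraphConnected V
  vgrp : V → Type w
  [vgroup : ∀ a, Group (vgrp a)]
  egrp : ∀ ⦃a b : V⦄, (a ⟶ b) → Type w
  [egroup : ∀ ⦃a b : V⦄ (e : a ⟶ b), Group (egrp e)]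
  /-- the monomorphism `Φₑ⁻` -/
  minus : ∀ ⦃a b : V⦄ (e : a ⟶ b), egrp e →* vgrp a
  /-- the monomorphism `Φₑ⁺` -/
  plus : ∀ ⦃a b : V⦄ (e : a ⟶ b), egrp e →* vgrp b
  minus_injective : ∀ ⦃a b : V⦄ (e : a ⟶ b), Function.Injective (minus e)
  plus_injective : ∀ ⦃a b : V⦄ (e : a ⟶ b), Function.Injective (plus e)

namespace GraphOfGroups

attribute [instance] GraphOfGroups.vgroup GraphOfGroups.egroup

variable {V : Type u} [Quiver.{v} V] (𝒢 : GraphOfGroups.{w} V)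

/-- The free product of all the vertex groups and of the free group on the letters `t_e`. -/
abbrev FreeProd : Type (max u v w) :=
  Monoid.Coprod (Monoid.CoprodI 𝒢.vgrp) (FreeGroup (Quiver.Total V))

/-- The elements of a vertex group, in the free product. -/
def genV (a : V) : 𝒢.vgrp a →* 𝒢.FreeProd :=
  Monoid.Coprod.inl.comp Monoid.CoprodI.of

/-- The letter `t_e`, in the free product. -/
def genE {a b : V} (e : a ⟶ b) : 𝒢.FreeProd :=
  Monoid.Coprod.inr (FreeGroup.of ⟨a, b, e⟩)

/-- The relators of the fundamental group with respect to a set `T` of edges: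
`t_e Φₑ⁻(x) t_e⁻¹ = Φₑ⁺(x)` for all edges `e` and all `x ∈ G_e`, and `t_e = 1` for `e ∈ T`. -/
inductive IsRelator (T : WideSubquiver V) : 𝒢.FreeProd → Prop
  | conj {a b : V} (e : a ⟶ b) (x : 𝒢.egrp e) :
      IsRelator T (𝒢.genE e * 𝒢.genV a (𝒢.minus e x) * (𝒢.genE e)⁻¹ * (𝒢.genV b (𝒢.plus e x))⁻¹)
  | tree {a b : V} (e : a ⟶ b) (he : e ∈ T a b) : IsRelator T (𝒢.genE e)

/-- The fundamental group of a graph of groups with respect to (the edge set of) a spanning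
tree `T`. -/
abbrev Pi1 (T : WideSubquiver V) : Type (max u v w) :=
  𝒢.FreeProd ⧸ Subgroup.normalClosure {r | 𝒢.IsRelator T r}

variable (T : WideSubquiver V)

/-- The canonical homomorphism from a vertex group to the fundamental group. -/
def ofV (a : V) : 𝒢.vgrp a →* 𝒢.Pi1 T :=
  (QuotientGroup.mk' _).comp (𝒢.genV a)

/-- The element `t_e` of the fundamental group. -/
def ofE {a b : V} (e : a ⟶ b) : 𝒢.Pi1 T :=
  QuotientGroup.mk' _ (𝒢.genE e)

theorem ofE_conj {a b : V} (e : a ⟶ b) (x : 𝒢.egrp e) :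
    𝒢.ofE T e * 𝒢.ofV T a (𝒢.minus e x) * (𝒢.ofE T e)⁻¹ = 𝒢.ofV T b (𝒢.plus e x) := by
  rw [← mul_inv_eq_one]
  exact (QuotientGroup.eq_one_iff _).2
    (Subgroup.subset_normalClosure (IsRelator.conj (T := T) e x))

/-- The vertices of the Bass–Serre tree: the cosets `g G_a`, for the vertices `a` of the graph.
The fundamental group acts on them by left multiplication. -/
abbrev BassSerreV : Type (max u v w) :=
  Σ a : V, 𝒢.Pi1 T ⧸ (𝒢.ofV T a).range

/-- The edges of the Bass–Serre tree: the cosets `g Φₑ⁻(G_e)`, for the edges `e` of the graph.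
The fundamental group acts on them by left multiplication. -/
abbrev BassSerreE : Type (max u v w) :=
  Σ e : Quiver.Total V, 𝒢.Pi1 T ⧸ ((𝒢.ofV T e.left).comp (𝒢.minus e.hom)).range

/-- The initial vertex of the edge `g Φₑ⁻(G_e)` of the Bass–Serre tree is `g G_{ι(e)}`. -/
def bsInit (ε : 𝒢.BassSerreE T) : 𝒢.BassSerreV T :=
  ⟨ε.1.left, Quotient.liftOn' ε.2 (fun g => (g : 𝒢.Pi1 T ⧸ (𝒢.ofV T ε.1.left).range)) (by
    intro g h hgh
    rw [QuotientGroup.leftRel_apply] at hgh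
    obtain ⟨x, hx⟩ := hgh
    exact QuotientGroup.eq.2 ⟨_, hx⟩)⟩

/-- The terminal vertex of the edge `g Φₑ⁻(G_e)` of the Bass–Serre tree is `g t_e⁻¹ G_{τ(e)}`. -/
def bsTerm (ε : 𝒢.BassSerreE T) : 𝒢.BassSerreV T :=
  ⟨ε.1.right, Quotient.liftOn' ε.2
    (fun g => ((g * (𝒢.ofE T ε.1.hom)⁻¹ : 𝒢.Pi1 T) : 𝒢.Pi1 T ⧸ (𝒢.ofV T ε.1.right).range)) (by
    intro g h hgh
    rw [QuotientGroup.leftRel_apply] at hgh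
    obtain ⟨x, hx⟩ := hgh
    refine QuotientGroup.eq.2 ⟨𝒢.plus ε.1.hom x, ?_⟩
    rw [← ofE_conj]
    rw [MonoidHom.comp_apply] at hx
    rw [hx]
    group)⟩

/-- Let `𝒢`, `ℋ` be graphs of groups with fundamental groups `G` and `H`, and let `f : H →* G` be
injective. The splitting `ℋ` of `H` is the one induced by the splitting `𝒢` of `G` if the
Bass–Serre tree of `ℋ` is `H`-equivariantly isomorphic to the Bass–Serre tree of `𝒢`, on
which `H` acts by restriction along `f`. -/
def IsInducedSplitting {W : Type u} [Quiver.{v} W] (ℋ : GraphOfGroups.{w} W)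
    (S : WideSubquiver W) (f : ℋ.Pi1 S →* 𝒢.Pi1 T) : Prop :=
  ∃ (αV : ℋ.BassSerreV S ≃ 𝒢.BassSerreV T) (αE : ℋ.BassSerreE S ≃ 𝒢.BassSerreE T),
    (∀ h x, αV (h • x) = f h • αV x) ∧
    (∀ h ε, αE (h • ε) = f h • αE ε) ∧
    (∀ ε, αV (ℋ.bsInit S ε) = 𝒢.bsInit T (αE ε)) ∧
    (∀ ε, αV (ℋ.bsTerm S ε) = 𝒢.bsTerm T (αE ε))

/-- Constant vertex groups. -/
def HasConstantVertexGroups : Prop :=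
  ∃ (K : Type w) (_ : Group K) (Ψ : ∀ a, 𝒢.vgrp a ≃* K),
    ∀ ⦃a b : V⦄ (e : a ⟶ b) (x : 𝒢.egrp e), Ψ a (𝒢.minus e x) = Ψ b (𝒢.plus e x)

/-- Isomorphisms `Θₑ : G_{ι(e)} → G_{τ(e)}` with `Θₑ ∘ Φₑ⁻ = Φₑ⁺`. A graph of groups with such
isomorphisms has locally constant vertex groups. -/
structure LocallyConstant where
  iso : ∀ ⦃a b : V⦄, (a ⟶ b) → (𝒢.vgrp a ≃* 𝒢.vgrp b)
  iso_minus : ∀ ⦃a b : V⦄ (e : a ⟶ b) (x : 𝒢.egrp e), iso e (𝒢.minus e x) = 𝒢.plus e x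

/-- The monodromy group at `a`: the image of `π₁(Γ, a) → Aut (G_a)`. -/
def LocallyConstant.monodromyGroup {𝒢 : GraphOfGroups.{w} V} (Θ : 𝒢.LocallyConstant) (a : V) :
    Subgroup (Aut (GrpCat.of (𝒢.vgrp a))) :=
  (monodromyHom (fun b => GrpCat.of (𝒢.vgrp b)) (fun _ _ e => (Θ.iso e).toGrpIso) a).range

end GraphOfGroups

/-! ### Cube complexes -/

/-- An isometry of the cube `[0,1]^m` onto a subcube of `[0,1]^n`. The `j`-th coordinate of the
image of `x` is the constant `0` or `1` if `coord j` is `inl false` or `inl true`, it is `x i` if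
`coord j = inr (i, false)`, and `1 - x i` if `coord j = inr (i, true)`; each `i` occurs exactly
once. -/
@[ext]
structure FaceMap (m n : ℕ) where
  coord : Fin n → Bool ⊕ (Fin m × Bool)
  existsUnique : ∀ i : Fin m, ∃! j : Fin n, ∃ r : Bool, coord j = Sum.inr (i, r)

namespace FaceMap

/-- The map of cubes itself. -/
def toFun {m n : ℕ} (f : FaceMap m n) (x : Fin m → I) : Fin n → I := fun j =>
  match f.coord j with
  | Sum.inl b => if b then 1 else 0
  | Sum.inr (i, r) => if r then unitInterval.symm (x i) else x i

/-- The identity of a cube. -/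
def id (n : ℕ) : FaceMap n n where
  coord j := Sum.inr (j, false)
  existsUnique i := ⟨i, ⟨false, rfl⟩, by rintro j ⟨r, hr⟩; simpa using congrArg (Sum.map _root_.id Prod.fst) hr⟩

/-- The composition `f ∘ g`. -/
def comp {k m n : ℕ} (f : FaceMap m n) (g : FaceMap k m) : FaceMap k n where
  coord j :=
    match f.coord j with
    | Sum.inl b => Sum.inl b
    | Sum.inr (i, r) =>
      match g.coord i with
      | Sum.inl b => Sum.inl (xor b r)
      | Sum.inr (l, s) => Sum.inr (l, xor s r)
  existsUnique l := by
    obtain ⟨i, ⟨s, hs⟩, hi⟩ := g.existsUnique l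
    obtain ⟨j, ⟨r, hr⟩, hj⟩ := f.existsUnique i
    refine ⟨j, ⟨xor s r, by simp [hr, hs]⟩, ?_⟩
    rintro j' ⟨q, hq⟩
    rcases h : f.coord j' with b | ⟨i', r'⟩
    · simp [h] at hq
    · rcases h' : g.coord i' with b | ⟨l', s'⟩
      · simp [h, h'] at hq
      · simp only [h, h', Sum.inr.injEq, Prod.mk.injEq] at hq
        obtain rfl : i' = i := hi i' ⟨s', by rw [h', hq.1]⟩
        exact hj j' ⟨r', h⟩

theorem toFun_id (n : ℕ) (x : Fin n → I) : (id n).toFun x = x := rfl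

theorem toFun_comp {k m n : ℕ} (f : FaceMap m n) (g : FaceMap k m) (x : Fin k → I) :
    (f.comp g).toFun x = f.toFun (g.toFun x) := by
  funext j
  rcases h : f.coord j with b | ⟨i, r⟩
  · simp [toFun, comp, h]
  · rcases h' : g.coord i with b | ⟨l, s⟩
    · cases b <;> cases r <;> simp [toFun, comp, h, h']
    · cases s <;> cases r <;> simp [toFun, comp, h, h']

/-- The vertex `(0, …, 0)` of the cube `[0,1]^n`. -/
def origin (n : ℕ) : FaceMap 0 n where
  coord _ := Sum.inl false
  existsUnique i := i.elim0

/-- The edge of the cube `[0,1]^n` that starts at `(0, …, 0)` in the `i`-th direction. -/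
def axis {n : ℕ} (i : Fin n) : FaceMap 1 n where
  coord j := if j = i then Sum.inr (0, false) else Sum.inl false
  existsUnique k := by
    refine ⟨i, ⟨false, by simp [Subsingleton.elim k 0]⟩, ?_⟩
    rintro j ⟨r, hr⟩
    by_contra hne
    simp [hne] at hr

end FaceMap

/-- A cube complex, obtained by gluing cubes along their subcubes by isometries. `cube n` is the
set of `n`-cubes together with a parametrization by `[0,1]^n` (so each `n`-cube of the complex
occurs here once for each of the `2ⁿ n!` isometries of `[0,1]^n`), and `face f c` is the
restriction of the parametrized cube `c` to a parametrized subcube `f` of `[0,1]^n`. The last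
condition says that no cube is glued to itself by a nontrivial isometry of `[0,1]^n`. -/
structure CubeComplex where
  cube : ℕ → Type w
  face : ∀ {m n : ℕ}, FaceMap m n → cube n → cube m
  face_id : ∀ {n : ℕ} (c : cube n), face (FaceMap.id n) c = c
  face_comp : ∀ {k m n : ℕ} (f : FaceMap m n) (g : FaceMap k m) (c : cube n),
    face (f.comp g) c = face g (face f c)
  face_free : ∀ {n : ℕ} (f : FaceMap n n) (c : cube n), face f c = c → f = FaceMap.id n

namespace CubeComplex

/-- A combinatorial map of cube complexes: it sends `n`-cubes isometrically to `n`-cubes. -/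
@[ext]
structure Hom (X Y : CubeComplex.{w}) where
  app : ∀ {n : ℕ}, X.cube n → Y.cube n
  app_face : ∀ {m n : ℕ} (f : FaceMap m n) (c : X.cube n), app (X.face f c) = Y.face f (app c)

/-- Cube complexes and combinatorial maps. The isomorphisms `X ≅ Y` are the cubical isometries, and
`Aut X` is the group of combinatorial automorphisms of `X`. -/
instance : Category CubeComplex.{w} where
  Hom := Hom
  id X := ⟨fun c => c, fun _ _ => rfl⟩
  comp f g := ⟨fun c => g.app (f.app c), fun φ c => by rw [f.app_face, g.app_face]⟩

/-- The points of the disjoint union of all the (parametrized) cubes. -/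
abbrev Pt (X : CubeComplex.{w}) : Type w :=
  Σ c : (Σ n, X.cube n), (Fin c.1 → I)

/-- The gluing of a subcube to the cube that contains it. -/
inductive Glue (X : CubeComplex.{w}) : X.Pt → X.Pt → Prop
  | glue {m n : ℕ} (f : FaceMap m n) (c : X.cube n) (x : Fin m → I) :
      Glue X ⟨⟨m, X.face f c⟩, x⟩ ⟨⟨n, c⟩, f.toFun x⟩

/-- The topological space underlying a cube complex: the quotient of the disjoint union of the cubes
by the gluing. -/
def Space (X : CubeComplex.{w}) : Type w := Quot X.Glue

instance (X : CubeComplex.{w}) : TopologicalSpace X.Space :=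
  inferInstanceAs (TopologicalSpace (Quot X.Glue))

/-- The continuous map underlying a combinatorial map. -/
def Hom.toMap {X Y : CubeComplex.{w}} (f : X ⟶ Y) : X.Space → Y.Space :=
  Quot.map (fun p : X.Pt => (⟨⟨p.1.1, Hom.app f p.1.2⟩, p.2⟩ : Y.Pt)) (by
    rintro _ _ ⟨φ, c, x⟩
    dsimp only
    rw [Hom.app_face]
    exact Glue.glue φ (Hom.app f c) x)

theorem Hom.toMap_comp {X Y Z : CubeComplex.{w}} (f : X ⟶ Y) (g : Y ⟶ Z) (x : X.Space) :
    Hom.toMap (f ≫ g) x = Hom.toMap g (Hom.toMap f x) := by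
  induction x using Quot.ind
  rfl

/-- The link of each vertex is a flag simplicial complex. The vertices of `lk(v)` are the directed
edges that start at `v`, and its simplices are the corners at `v` of cubes; a corner of an
`n`-cube, with an ordering of the `n` directed edges in it, is an element `c` of `cube n` with
origin `v`. The three conditions are: the vertices of a simplex of the link are distinct; a simplex
is determined by its vertices; finitely many pairwise adjacent vertices span a simplex. -/
structure IsNonpositivelyCurved (X : CubeComplex.{w}) : Prop where
  axis_injective : ∀ (n : ℕ) (c : X.cube n), Function.Injective fun i => X.face (FaceMap.axis i) c
  corner_ext : ∀ (n : ℕ) (c d : X.cube n),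
    X.face (FaceMap.origin n) c = X.face (FaceMap.origin n) d →
    (∀ i, X.face (FaceMap.axis i) c = X.face (FaceMap.axis i) d) → c = d
  flag : ∀ (p : X.cube 0) (n : ℕ) (e : Fin n → X.cube 1), Function.Injective e →
    (∀ i, X.face (FaceMap.origin 1) (e i) = p) →
    (∀ i j, i ≠ j → ∃ s : X.cube 2,
      X.face (FaceMap.axis 0) s = e i ∧ X.face (FaceMap.axis 1) s = e j) →
    ∃ c : X.cube n, X.face (FaceMap.origin n) c = p ∧ ∀ i, X.face (FaceMap.axis i) c = e i

/-- A combinatorial map is a local isometry if the induced maps of links of vertices are embeddings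
with full image. -/
structure IsLocalIsometry {Y X : CubeComplex.{w}} (f : Y ⟶ X) : Prop where
  link_injective : ∀ (n : ℕ) (c d : Y.cube n),
    Y.face (FaceMap.origin n) c = Y.face (FaceMap.origin n) d → Hom.app f c = Hom.app f d → c = d
  link_full : ∀ (p : Y.cube 0) (n : ℕ) (c : X.cube n),
    X.face (FaceMap.origin n) c = Hom.app f p →
    (∀ i, ∃ e : Y.cube 1,
      Y.face (FaceMap.origin 1) e = p ∧ Hom.app f e = X.face (FaceMap.axis i) c) →
    ∃ d : Y.cube n, Y.face (FaceMap.origin n) d = p ∧ Hom.app f d = c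

end CubeComplex

/-! ### Graphs of cube complexes -/

/-- A graph of nonpositively curved cube complexes over the connected graph `V`. -/
structure GraphOfCubeComplexes (V : Type u) [Quiver.{v} V] where
  connected : GraphConnected V
  vsp : V → CubeComplex.{w}
  vsp_npc : ∀ a, (vsp a).IsNonpositivelyCurved
  vsp_connected : ∀ a, ConnectedSpace (vsp a).Space
  esp : ∀ ⦃a b : V⦄, (a ⟶ b) → CubeComplex.{w}
  esp_npc : ∀ ⦃a b : V⦄ (e : a ⟶ b), (esp e).IsNonpositivelyCurved
  esp_connected : ∀ ⦃a b : V⦄ (e : a ⟶ b), ConnectedSpace (esp e).Space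
  /-- the attaching map `φₑ⁻` -/
  minus : ∀ ⦃a b : V⦄ (e : a ⟶ b), esp e ⟶ vsp a
  /-- the attaching map `φₑ⁺` -/
  plus : ∀ ⦃a b : V⦄ (e : a ⟶ b), esp e ⟶ vsp b
  minus_localIsometry : ∀ ⦃a b : V⦄ (e : a ⟶ b), CubeComplex.IsLocalIsometry (minus e)
  plus_localIsometry : ∀ ⦃a b : V⦄ (e : a ⟶ b), CubeComplex.IsLocalIsometry (plus e)

namespace GraphOfCubeComplexes

variable {V : Type u} [Quiver.{v} V] (𝒳 : GraphOfCubeComplexes.{w} V)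

/-- The disjoint union of the vertex spaces and of the thickened edge spaces. -/
abbrev Pieces : Type (max u v w) :=
  (Σ a : V, (𝒳.vsp a).Space) ⊕ (Σ e : Quiver.Total V, (𝒳.esp e.hom).Space × I)

/-- The ends of a thickened edge space are glued to vertex spaces by the attaching maps. -/
inductive Glue : 𝒳.Pieces → 𝒳.Pieces → Prop
  | zero {a b : V} (e : a ⟶ b) (x : (𝒳.esp e).Space) :
      Glue (Sum.inr ⟨⟨a, b, e⟩, (x, 0)⟩) (Sum.inl ⟨a, CubeComplex.Hom.toMap (𝒳.minus e) x⟩)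
  | one {a b : V} (e : a ⟶ b) (x : (𝒳.esp e).Space) :
      Glue (Sum.inr ⟨⟨a, b, e⟩, (x, 1)⟩) (Sum.inl ⟨b, CubeComplex.Hom.toMap (𝒳.plus e) x⟩)

/-- The total space. -/
def TotalSpace : Type (max u v w) := Quot 𝒳.Glue

instance : TopologicalSpace 𝒳.TotalSpace :=
  inferInstanceAs (TopologicalSpace (Quot 𝒳.Glue))

/-- Constant vertex spaces. -/
def HasConstantVertexSpaces : Prop :=
  ∃ (K : CubeComplex.{w}) (ψ : ∀ a, 𝒳.vsp a ≅ K),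
    K.IsNonpositivelyCurved ∧ ConnectedSpace K.Space ∧
    ∀ ⦃a b : V⦄ (e : a ⟶ b), 𝒳.minus e ≫ (ψ a).hom = 𝒳.plus e ≫ (ψ b).hom

/-- Cubical isometries `θₑ : X_{ι(e)} → X_{τ(e)}` with `θₑ ∘ φₑ⁻ = φₑ⁺`. A graph of cube complexes
with such isometries has locally constant vertex spaces. -/
structure LocallyConstant where
  iso : ∀ ⦃a b : V⦄, (a ⟶ b) → (𝒳.vsp a ≅ 𝒳.vsp b)
  minus_iso : ∀ ⦃a b : V⦄ (e : a ⟶ b), 𝒳.minus e ≫ (iso e).hom = 𝒳.plus e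

/-- The monodromy group at `a`: the image of `π₁(Γ, a) → Aut (X_a)`. -/
def LocallyConstant.monodromyGroup {𝒳 : GraphOfCubeComplexes.{w} V} (θ : 𝒳.LocallyConstant)
    (a : V) : Subgroup (Aut (𝒳.vsp a)) :=
  (monodromyHom 𝒳.vsp θ.iso a).range

/-- A morphism of graphs of cube complexes: a morphism `p` of the underlying graphs with
combinatorial maps of vertex spaces and of edge spaces that commute with the attaching maps. -/
structure Hom {W : Type u} [Quiver.{v} W] (𝒴 : GraphOfCubeComplexes.{w} W)
    (𝒳 : GraphOfCubeComplexes.{w} V) where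
  base : W ⥤q V
  vmap : ∀ a : W, 𝒴.vsp a ⟶ 𝒳.vsp (base.obj a)
  emap : ∀ ⦃a b : W⦄ (e : a ⟶ b), 𝒴.esp e ⟶ 𝒳.esp (base.map e)
  minus_vmap : ∀ ⦃a b : W⦄ (e : a ⟶ b), 𝒴.minus e ≫ vmap a = emap e ≫ 𝒳.minus (base.map e)
  plus_vmap : ∀ ⦃a b : W⦄ (e : a ⟶ b), 𝒴.plus e ≫ vmap b = emap e ≫ 𝒳.plus (base.map e)

/-- The map of total spaces given by a morphism of graphs of cube complexes; it respects the
decompositions into vertex spaces and thickened edge spaces. -/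
def Hom.totalMap {W : Type u} [Quiver.{v} W] {𝒴 : GraphOfCubeComplexes.{w} W}
    {𝒳 : GraphOfCubeComplexes.{w} V} (q : Hom 𝒴 𝒳) : 𝒴.TotalSpace → 𝒳.TotalSpace :=
  Quot.map
    (Sum.map
      (fun x => ⟨q.base.obj x.1, CubeComplex.Hom.toMap (q.vmap x.1) x.2⟩)
      (fun x => ⟨⟨q.base.obj x.1.left, q.base.obj x.1.right, q.base.map x.1.hom⟩,
        (CubeComplex.Hom.toMap (q.emap x.1.hom) x.2.1, x.2.2)⟩))
    (by
      rintro _ _ (⟨e, x⟩ | ⟨e, x⟩)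
      · dsimp only [Sum.map_inl, Sum.map_inr]
        rw [← CubeComplex.Hom.toMap_comp, q.minus_vmap, CubeComplex.Hom.toMap_comp]
        exact Glue.zero _ _
      · dsimp only [Sum.map_inl, Sum.map_inr]
        rw [← CubeComplex.Hom.toMap_comp, q.plus_vmap, CubeComplex.Hom.toMap_comp]
        exact Glue.one _ _)

/-- The total space of `𝒴` is a finite-sheeted cover of the total space of `𝒳`, and the splitting
`𝒴` of the cover is the one induced by `𝒳`: the covering map is the map of total spaces given by
`q`. -/
def Hom.IsFiniteCover {W : Type u} [Quiver.{v} W] {𝒴 : GraphOfCubeComplexes.{w} W}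
    {𝒳 : GraphOfCubeComplexes.{w} V} (q : Hom 𝒴 𝒳) : Prop :=
  IsCoveringMap q.totalMap ∧ ∃ d : ℕ, d ≠ 0 ∧ ∀ x, Nat.card (q.totalMap ⁻¹' {x}) = d

end GraphOfCubeComplexes

/-! Transport along edge paths is a functor on the free groupoid of the graph, so groups and cube
complexes are treated alike. Fix paths `p b` from a base vertex. If the monodromy is trivial,
transport back along these paths identifies all fibres with the base fibre, compatibly with every
edge (`exists_trivialization`).

If the monodromy group is finite, let `Q` be a copy of it and label each edge `e : b ⟶ c` by the
monodromy of the loop `p b ≫ e ≫ inv (p c)`. The derived graph of this labelling, with vertices `V ×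
Q`, is a connected finite cover of the graph. On the sheet `g`, correcting the transport by `g⁻¹`
absorbs the labels, so the pulled back fibres are constant (`exists_derived_trivialization`).

It remains to see that the pullback is what is asked for. For groups, choose the paths inside the
spanning tree; the labels are then trivial on the tree and define `χ : G → Q`. The group `H` of the
pullback maps to `G` with image `ker χ`; injectivity and the image come from an action of `G` on `Q
× H`, which recovers an element of `H` from its image (`exists_derived_hom`). Cosets of vertex and
edge groups then match, which gives the isomorphism of Bass–Serre trees
(`isInducedSplitting_derived`).

For spaces, `Q` acts on the total space of the pullback by deck transformations whose orbits are the
fibres of the projection; open stars and edge interiors are moved off themselves, so the projection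
is a covering with `Nat.card Q` sheets (`isQuotientCoveringMap_derivedProj`). A compact cube complex
has finitely many cubes, because the centers of cubes form a closed discrete set; hence its
automorphism group, and so the monodromy group, is finite (`finite_aut`). -/

/-! ### Graphs and their free groupoids -/

section FreeGroupoid

variable {V : Type u} [Quiver.{v} V]

/-- A vertex of a graph, as an object of the free groupoid. -/
abbrev graphPt (a : V) : Quiver.FreeGroupoid V := (Quiver.FreeGroupoid.of V).obj a

/-- An edge of a graph, as a morphism of the free groupoid. -/
abbrev graphEdge {a b : V} (e : a ⟶ b) : graphPt a ⟶ graphPt b := (Quiver.FreeGroupoid.of V).map e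

/-- Morphisms are classes of paths in the symmetrified graph, so this is induction on the length of
a representing path. -/
theorem Quiver.FreeGroupoid.hom_induction {a : V} (P : ∀ b : V, (graphPt a ⟶ graphPt b) → Prop)
    (nil : P a (𝟙 _))
    (pos : ∀ (b c : V) (m : graphPt a ⟶ graphPt b) (e : b ⟶ c), P b m → P c (m ≫ graphEdge e))
    (neg : ∀ (b c : V) (m : graphPt a ⟶ graphPt b) (e : c ⟶ b),
      P b m → P c (m ≫ inv (graphEdge e)))
    (b : V) (m : graphPt a ⟶ graphPt b) : P b m := by
  obtain ⟨p, rfl⟩ : ∃ p : Quiver.Path (V := Quiver.Symmetrify V) a b, Quot.mk _ p = m :=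
    Quot.exists_rep m
  induction p with
  | nil => exact nil
  | cons q e ih =>
    rcases e with e | e
    · exact pos _ _ _ e ih
    · have := neg _ _ _ e ih
      rw [← Groupoid.inv_eq_inv] at this
      exact this

theorem Quiver.FreeGroupoid.nonempty_hom_of_path {a b : V}
    (p : Quiver.Path (V := Quiver.Symmetrify V) a b) : Nonempty (graphPt a ⟶ graphPt b) :=
  ⟨Quot.mk _ p⟩

theorem GraphConnected.nonempty_hom (h : GraphConnected V) (a b : V) :
    Nonempty (graphPt a ⟶ graphPt b) := by
  obtain ⟨p⟩ := h.2 a b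
  exact Quiver.FreeGroupoid.nonempty_hom_of_path p

theorem Quiver.FreeGroupoid.const_of_edges {S : Type*} (f : V → S)
    (hf : ∀ ⦃a b : V⦄, (a ⟶ b) → f a = f b) {a b : V} (m : graphPt a ⟶ graphPt b) :
    f a = f b :=
  Quiver.FreeGroupoid.hom_induction (fun b _ => f a = f b) rfl
    (fun _ _ _ e h => h.trans (hf e)) (fun _ _ _ e h => h.trans (hf e).symm) b m

/-- This propagates identities from a base vertex to all vertices when they can be checked across
tree edges. -/
theorem IsSpanningTree.const_of_edges {T : WideSubquiver V} (hT : IsSpanningTree T) {S : Type*}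
    (f : V → S) (hf : ∀ ⦃a b : V⦄ (e : a ⟶ b), e ∈ T a b → f a = f b) (a b : V) : f a = f b := by
  obtain ⟨⟨⟨m⟩, -⟩⟩ := hT (graphPt (V := T) a) (graphPt (V := T) b)
  exact Quiver.FreeGroupoid.const_of_edges (V := T) f (fun _ _ (e : Subtype _) => hf e.1 e.2) m

theorem Quiver.FreeGroupoid.lift_map_graphEdge {D : Type*} [Groupoid D] (φ : V ⥤q D) {a b : V}
    (e : a ⟶ b) : (Quiver.FreeGroupoid.lift φ).map (graphEdge e) = φ.map e :=
  Category.id_comp _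

/-- The labelling extends to a functor to the one-object groupoid of `M`, and `s a` is its value on
the unique morphism from `a` to `r`. Composition in `SingleObj M` reverses multiplication, whence
the order in `s b * τ e`. -/
theorem Quiver.FreeGroupoid.exists_gauge (h : ∀ a b : Quiver.FreeGroupoid V, Nonempty (Unique (a ⟶ b)))
    {M : Type*} [Group M] (τ : ∀ ⦃a b : V⦄, (a ⟶ b) → M) (r : V) :
    ∃ s : V → M, s r = 1 ∧ ∀ ⦃a b : V⦄ (e : a ⟶ b), s b * τ e = s a := by
  let Φ : Quiver.FreeGroupoid V ⥤ SingleObj M := Quiver.FreeGroupoid.lift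
    { obj := fun _ => SingleObj.star M
      map := fun {a b} e => (τ e : M) }
  have uniq : ∀ {a b : Quiver.FreeGroupoid V} (f g : a ⟶ b), f = g := fun {a b} f g => by
    obtain ⟨hu⟩ := h a b
    exact (hu.uniq f).trans (hu.uniq g).symm
  let p : ∀ a : V, graphPt a ⟶ graphPt r := fun a => (h (graphPt a) (graphPt r)).some.default
  refine ⟨fun a => Φ.map (p a), ?_, fun a b e => ?_⟩
  · have h1 : Φ.map (p r) = 𝟙 _ := by rw [uniq (p r) (𝟙 _), Φ.map_id]
    exact h1
  · have h1 : Φ.map (p a) = Φ.map (graphEdge e) ≫ Φ.map (p b) := by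
      rw [uniq (p a) (graphEdge e ≫ p b), Φ.map_comp]
    have h2 : Φ.map (graphEdge e) = (τ e : M) := Quiver.FreeGroupoid.lift_map_graphEdge _ _
    exact (h1.trans (congrArg (· ≫ Φ.map (p b)) h2)).symm

/-- A labelling of the edges by the elements of a group is trivial on a spanning tree up to
a gauge transformation. -/
theorem IsSpanningTree.exists_gauge {T : WideSubquiver V} (hT : IsSpanningTree T) {M : Type*}
    [Group M] (τ : ∀ ⦃a b : V⦄, (a ⟶ b) → M) (r : V) :
    ∃ s : V → M, s r = 1 ∧ ∀ ⦃a b : V⦄ (e : a ⟶ b), e ∈ T a b → s b * τ e = s a := by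
  obtain ⟨s, h1, hs⟩ := Quiver.FreeGroupoid.exists_gauge (V := T) hT
    (fun _ _ (e : Subtype _) => τ e.1) r
  exact ⟨s, h1, fun a b e he => hs (a := a) (b := b) ⟨e, he⟩⟩

/-- In a spanning tree there are paths from a given vertex that are compatible with the edges. -/
theorem IsSpanningTree.exists_paths {T : WideSubquiver V} (hT : IsSpanningTree T) (r : V) :
    ∃ p : ∀ a : V, graphPt r ⟶ graphPt a,
      ∀ ⦃a b : V⦄ (e : a ⟶ b), e ∈ T a b → p a ≫ graphEdge e = p b := by
  let Φ : Quiver.FreeGroupoid T ⥤ Quiver.FreeGroupoid V := Quiver.FreeGroupoid.lift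
    { obj := fun a => graphPt (V := V) a
      map := fun {a b} (e : {e : _ // e ∈ T a b}) => graphEdge (V := V) e.1 }
  have uniq : ∀ {a b : Quiver.FreeGroupoid T} (f g : a ⟶ b), f = g := fun {a b} f g => by
    obtain ⟨hu⟩ := hT a b
    exact (hu.uniq f).trans (hu.uniq g).symm
  let p : ∀ a : T, graphPt (V := T) r ⟶ graphPt a := fun a =>
    (hT (graphPt r) (graphPt a)).some.default
  refine ⟨fun a => Φ.map (p a), fun a b e he => ?_⟩
  let e' : Quiver.Hom (V := T) a b := ⟨e, he⟩
  have h1 : Φ.map (p b) = Φ.map (p a) ≫ Φ.map (graphEdge e') := by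
    rw [← Φ.map_comp, uniq (p b)]
  have h2 : Φ.map (graphEdge e') = graphEdge e := Quiver.FreeGroupoid.lift_map_graphEdge _ _
  exact (h1.trans (congrArg (Φ.map (p a) ≫ ·) h2)).symm

/-- Induction on `m` gives `φ a ≫ m = φ c`, so `m` is forced to be `inv (φ a) ≫ φ c`. -/
theorem Quiver.FreeGroupoid.codiscrete_of_paths {r : Quiver.FreeGroupoid V}
    (φ : ∀ b : V, r ⟶ graphPt b) (hφ : ∀ ⦃a b : V⦄ (e : a ⟶ b), φ a ≫ graphEdge e = φ b)
    (a b : Quiver.FreeGroupoid V) : Nonempty (Unique (a ⟶ b)) := by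
  obtain ⟨a⟩ := a
  obtain ⟨b⟩ := b
  change Nonempty (Unique (graphPt (V := V) a ⟶ graphPt (V := V) b))
  have key : ∀ (c : V) (m : graphPt (V := V) a ⟶ graphPt c), φ a ≫ m = φ c := by
    refine Quiver.FreeGroupoid.hom_induction _ (Category.comp_id _) ?_ ?_
    · intro b c m e h
      rw [← Category.assoc, h, hφ]
    · intro b c m e h
      rw [← Category.assoc, h, IsIso.comp_inv_eq, hφ]
  exact ⟨⟨⟨inv (φ a) ≫ φ b⟩, fun m =>
    ((IsIso.eq_inv_comp _).2 (key b m) : m = inv (φ a) ≫ φ b)⟩⟩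

/-- Take the image of the unique path from the root: appending an edge to the path to its source
yields the path to its target. -/
theorem Quiver.Arborescence.exists_paths {A : Type*} [Quiver A] [Quiver.Arborescence A]
    {D : Type*} [Category* D] (F : A ⥤q D) :
    ∃ φ : ∀ b : A, F.obj (Quiver.root A) ⟶ F.obj b,
      ∀ ⦃a b : A⦄ (e : a ⟶ b), φ a ≫ F.map e = φ b := by
  refine ⟨fun b => (Paths.lift F).map (default : Quiver.Path (Quiver.root A) b),
    fun a b e => ?_⟩
  have h := Subsingleton.elim (Quiver.Path.cons default e) (default : Quiver.Path (Quiver.root A) b)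
  exact congrArg (fun q : Quiver.Path (Quiver.root A) b => (Paths.lift F).map q) h

theorem GraphConnected.exists_isSpanningTree (hV : GraphConnected V) :
    ∃ T : WideSubquiver V, IsSpanningTree T := by
  obtain ⟨⟨r⟩, hc⟩ := hV
  let r' : Quiver.Symmetrify V := r
  have : Quiver.RootedConnected r' := ⟨fun b => hc r' b⟩
  -- The edges that the geodesic subtree of the symmetrified graph uses in at least one direction;
  -- those used backwards act as inverses in the groupoid.
  let T : WideSubquiver V := fun a b =>
    {e | Sum.inl e ∈ Quiver.geodesicSubtree r' a b ∨ Sum.inr e ∈ Quiver.geodesicSubtree r' b a}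
  let F : Quiver.geodesicSubtree r' ⥤q Quiver.FreeGroupoid T :=
    { obj := fun a => graphPt (V := T) a
      map := fun {a b} (e : {e : _ // e ∈ Quiver.geodesicSubtree r' a b}) =>
        match e with
        | ⟨Sum.inl e, he⟩ => graphEdge (V := T) (a := a) (b := b) ⟨e, Or.inl he⟩
        | ⟨Sum.inr e, he⟩ => inv (graphEdge (V := T) (a := b) (b := a) ⟨e, Or.inr he⟩) }
  obtain ⟨φ, hφ⟩ := Quiver.Arborescence.exists_paths F
  refine ⟨T, Quiver.FreeGroupoid.codiscrete_of_paths (V := T) φ ?_⟩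
  rintro a b ⟨e, he | he⟩
  · exact hφ (a := a) (b := b) ⟨Sum.inl e, he⟩
  · have := hφ (a := b) (b := a) ⟨Sum.inr e, he⟩
    exact ((IsIso.comp_inv_eq _).1 this).symm

end FreeGroupoid

/-! ### Derived graphs of voltage graphs -/

section Derived

variable {V : Type u} [Quiver.{v} V] {Q : Type} [Group Q]

/-- The derived graph of a labelling `ρ` of the edges by elements of `Q`: the vertices are the
pairs `(a, g)`, and `e : a ⟶ b` lifts to edges from `(a, g)` to `(b, ρ e * g)`. -/
structure DerivedGraph (ρ : ∀ ⦃a b : V⦄, (a ⟶ b) → Q) : Type u where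
  base : V
  sheet : Q

variable (ρ : ∀ ⦃a b : V⦄, (a ⟶ b) → Q)

instance : Quiver.{v} (DerivedGraph ρ) where
  Hom x y := {e : x.base ⟶ y.base // ρ e * x.sheet = y.sheet}

/-- The lift of an edge that starts at `(a, g)`. -/
def DerivedGraph.lift {a b : V} (e : a ⟶ b) (g : Q) :
    (⟨a, g⟩ : DerivedGraph ρ) ⟶ (⟨b, ρ e * g⟩ : DerivedGraph ρ) := ⟨e, rfl⟩

/-- The equation on the sheets determines the target, so it can be substituted away and only lifts
of edges need to be considered. -/
theorem DerivedGraph.hom_cases {P : ∀ ⦃x y : DerivedGraph ρ⦄, (x ⟶ y) → Prop}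
    (h : ∀ {a b : V} (e : a ⟶ b) (g : Q), P (DerivedGraph.lift ρ e g))
    ⦃x y : DerivedGraph ρ⦄ (e : x ⟶ y) : P e := by
  obtain ⟨a, g⟩ := x
  obtain ⟨b, g'⟩ := y
  obtain ⟨e, he⟩ := e
  change a ⟶ b at e
  change ρ e * g = g' at he
  subst he
  exact h e g

end Derived

/-! ### Transport and monodromy -/

section Transport

variable {V : Type u} [Quiver.{v} V] {C : Type*} [Category* C] (F : V → C)
  (θ : ∀ ⦃a b : V⦄, (a ⟶ b) → (F a ≅ F b))

theorem edgeTransport_map_graphEdge {a b : V} (e : a ⟶ b) :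
    (edgeTransport F θ).map (graphEdge e) = (θ e).hom := by
  exact Category.id_comp _

/-- Transport along chosen paths from a base vertex. -/
noncomputable def transportIso {a : V} (p : ∀ b : V, graphPt a ⟶ graphPt b) (b : V) : F b ≅ F a :=
  ((edgeTransport F θ).mapIso (asIso (p b))).symm

/-- The loop obtained from a morphism by joining its ends to the base vertex. -/
noncomputable def loopOf {a : V} (p : ∀ b : V, graphPt a ⟶ graphPt b) {b c : V}
    (m : graphPt b ⟶ graphPt c) : GraphPi1 V a := asIso (p b ≫ m ≫ inv (p c))

theorem loopOf_comp {a : V} (p : ∀ b : V, graphPt a ⟶ graphPt b) {b c d : V}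
    (m : graphPt b ⟶ graphPt c) (n : graphPt c ⟶ graphPt d) :
    loopOf p (m ≫ n) = loopOf p n * loopOf p m := by
  ext
  change p b ≫ (m ≫ n) ≫ inv (p d) = (p b ≫ m ≫ inv (p c)) ≫ p c ≫ n ≫ inv (p d)
  simp

/-- Crossing `e` and then returning to the base vertex differs from returning at once by the
monodromy of the loop through `e`. Both trivializations below rest on this. -/
theorem transportIso_edge {a : V} (p : ∀ b : V, graphPt a ⟶ graphPt b) {b c : V} (e : b ⟶ c) :
    θ e ≪≫ transportIso F θ p c =
      transportIso F θ p b ≪≫ monodromyHom F θ a (loopOf p (graphEdge e)) := by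
  ext
  have h : (edgeTransport F θ).map (graphEdge e) ≫ (edgeTransport F θ).map (inv (p c)) =
      (edgeTransport F θ).map (inv (p b)) ≫
        (edgeTransport F θ).map (p b ≫ graphEdge e ≫ inv (p c)) := by
    rw [← Functor.map_comp, ← Functor.map_comp, IsIso.inv_hom_id_assoc]
  rw [edgeTransport_map_graphEdge] at h
  exact h

/-- Trivial monodromy allows one to identify all fibres. -/
theorem exists_trivialization (hV : GraphConnected V) (a : V)
    (h : (monodromyHom F θ a).range = ⊥) :
    ∃ ψ : ∀ b, F b ≅ F a, ∀ ⦃b c : V⦄ (e : b ⟶ c), θ e ≪≫ ψ c = ψ b := by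
  have p' : ∀ b, graphPt a ⟶ graphPt b := fun b => (hV.nonempty_hom a b).some
  refine ⟨transportIso F θ p', fun b c e => ?_⟩
  have h1 : monodromyHom F θ a (loopOf p' (graphEdge e)) = 1 := by
    rw [← Subgroup.mem_bot, ← h]
    exact ⟨_, rfl⟩
  rw [transportIso_edge, h1]
  exact Iso.trans_refl _

/-- Finite monodromy: on the derived graph of a labelling by a finite group, all fibres can be
identified. -/
theorem exists_derived_trivialization {a : V}
    (p : ∀ b : V, graphPt a ⟶ graphPt b) [Finite (monodromyHom F θ a).range] :
    ∃ (Q : Type) (_ : Group Q) (_ : Finite Q) (ρ : ∀ ⦃b c : V⦄, (b ⟶ c) → Q),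
      (∀ ⦃b c : V⦄ (e : b ⟶ c), p b ≫ graphEdge e = p c → ρ e = 1) ∧
      GraphConnected (DerivedGraph ρ) ∧
      ∃ ψ : ∀ x : DerivedGraph ρ, F x.base ≅ F a,
        ∀ ⦃x y : DerivedGraph ρ⦄ (e : x ⟶ y), θ e.1 ≪≫ ψ y = ψ x := by
  let M := (monodromyHom F θ a).range
  -- A finite group has a copy in `Type`, which keeps the derived graph in the universe of `V`.
  have : Small.{0} M := Countable.toSmall M
  let ν : Shrink.{0} M ≃* M := Shrink.mulEquiv
  let R : ∀ {b c : V}, (graphPt b ⟶ graphPt c) → Shrink.{0} M := fun m =>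
    ν.symm ⟨monodromyHom F θ a (loopOf p m), _, rfl⟩
  have R_comp : ∀ {b c d : V} (m : graphPt b ⟶ graphPt c) (n : graphPt c ⟶ graphPt d),
      R (m ≫ n) = R n * R m := fun m n => by
    simp only [R]
    rw [← map_mul]
    congr 1
    ext1
    simp [loopOf_comp]
  have R_id : ∀ b : V, R (𝟙 (graphPt b)) = 1 := fun b => by
    have := R_comp (𝟙 (graphPt b)) (𝟙 (graphPt b))
    rw [Category.comp_id] at this
    exact (left_eq_mul.1 this)
  have R_inv : ∀ {b c : V} (m : graphPt b ⟶ graphPt c), R (inv m) = (R m)⁻¹ := fun {b c} m => by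
    rw [eq_inv_iff_mul_eq_one, ← R_comp, IsIso.hom_inv_id, R_id]
  let ρ : ∀ ⦃b c : V⦄, (b ⟶ c) → Shrink.{0} M := fun b c e => R (graphEdge e)
  refine ⟨Shrink.{0} M, inferInstance, Finite.of_equiv M (equivShrink M), ρ, ?_, ?_,
    -- Crossing `e` multiplies the sheet by `ρ e` on the left; the inverse of the sheet cancels the
    -- monodromy that crossing `e` contributes.
    fun x => transportIso F θ p x.base ≪≫ (((ν x.sheet)⁻¹ : M) : Aut (F a)), ?_⟩
  · intro b c e he
    have : loopOf p (graphEdge e) = 1 := by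
      ext
      simp only [loopOf, asIso_hom]
      rw [← Category.assoc, he, IsIso.hom_inv_id]
      rfl
    simp only [ρ, R, this, map_one]
    exact map_one ν.symm
  · have lift : ∀ (b c : V) (g : Shrink.{0} M) (m : graphPt b ⟶ graphPt c),
        Nonempty (Quiver.Path (V := Quiver.Symmetrify (DerivedGraph ρ)) ⟨b, g⟩ ⟨c, R m * g⟩) := by
      intro b c g m
      refine Quiver.FreeGroupoid.hom_induction (fun c m => Nonempty (Quiver.Path
        (V := Quiver.Symmetrify (DerivedGraph ρ)) ⟨b, g⟩ ⟨c, R m * g⟩)) ?_ ?_ ?_ c m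
      · rw [R_id, one_mul]
        exact ⟨Quiver.Path.nil⟩
      · rintro c d m e ⟨q⟩
        rw [R_comp, mul_assoc]
        exact ⟨q.cons (Sum.inl (DerivedGraph.lift ρ e _))⟩
      · rintro c d m e ⟨q⟩
        refine ⟨q.cons (Sum.inr ⟨e, ?_⟩)⟩
        change R (graphEdge e) * (R (m ≫ inv (graphEdge e)) * g) = R m * g
        rw [R_comp, R_inv, mul_assoc, mul_inv_cancel_left]
    -- `Q` is exactly the image of the monodromy, so each of its elements comes from a loop at `a`,
    -- carried to `b` and `c` along the chosen paths. With path lifting, this makes the derived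
    -- graph connected.
    have surj : ∀ (b c : V) (q : Shrink.{0} M), ∃ m : graphPt b ⟶ graphPt c, R m = q := by
      intro b c q
      obtain ⟨ℓ, hℓ⟩ := (ν q).2
      refine ⟨inv (p b) ≫ ℓ.hom ≫ p c, ?_⟩
      have : loopOf p (inv (p b) ≫ ℓ.hom ≫ p c) = ℓ := by
        ext
        simp [loopOf]
      simp only [R, this]
      rw [MulEquiv.symm_apply_eq]
      exact Subtype.ext hℓ
    refine ⟨⟨⟨a, 1⟩⟩, ?_⟩
    rintro ⟨b, g⟩ ⟨c, h⟩
    obtain ⟨m, hm⟩ := surj b c (h * g⁻¹)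
    have := lift b c g m
    rwa [hm, inv_mul_cancel_right] at this
  · refine DerivedGraph.hom_cases ρ fun {b c} e g => ?_
    change θ e ≪≫ transportIso F θ p c ≪≫ (((ν (ρ e * g))⁻¹ : M) : Aut (F a)) =
      transportIso F θ p b ≪≫ (((ν g)⁻¹ : M) : Aut (F a))
    refine (Iso.trans_assoc _ _ _).symm.trans ?_
    rw [transportIso_edge]
    refine (Iso.trans_assoc _ _ _).trans ?_
    refine congrArg (fun t : F a ≅ F a => transportIso F θ p b ≪≫ t) ?_
    change ((((ν (ρ e * g))⁻¹ : M) : Aut (F a)) * monodromyHom F θ a (loopOf p (graphEdge e))) = _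
    have : monodromyHom F θ a (loopOf p (graphEdge e)) = (ν (ρ e) : M) := by
      simp only [ρ, R, MulEquiv.apply_symm_apply]
    rw [this, ← Subgroup.coe_mul, map_mul, mul_inv_rev, inv_mul_cancel_right]

end Transport

/-! ### Fundamental groups of graphs of groups -/

namespace GraphOfGroups

variable {V : Type u} [Quiver.{v} V] (𝒢 : GraphOfGroups.{w} V) (T : WideSubquiver V)

section UniversalProperty

variable {M : Type*} [Group M]

/-- The universal property of the fundamental group of a graph of groups. -/
def pi1Lift (φ : ∀ a, 𝒢.vgrp a →* M) (τ : ∀ ⦃a b : V⦄, (a ⟶ b) → M)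
    (hconj : ∀ ⦃a b : V⦄ (e : a ⟶ b) (x : 𝒢.egrp e),
      τ e * φ a (𝒢.minus e x) = φ b (𝒢.plus e x) * τ e)
    (htree : ∀ ⦃a b : V⦄ (e : a ⟶ b), e ∈ T a b → τ e = 1) : 𝒢.Pi1 T →* M :=
  QuotientGroup.lift _
    (Monoid.Coprod.lift (Monoid.CoprodI.lift φ) (FreeGroup.lift fun e => τ e.hom)) (by
      refine Subgroup.normalClosure_le_normal ?_
      rintro _ (⟨e, x⟩ | ⟨e, he⟩)
      · change _ = _
        simp only [genE, genV, map_mul, map_inv, MonoidHom.comp_apply,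
          Monoid.Coprod.lift_apply_inl, Monoid.Coprod.lift_apply_inr, FreeGroup.lift_apply_of,
          Monoid.CoprodI.lift_of, hconj]
        group
      · change _ = _
        simp only [genE, Monoid.Coprod.lift_apply_inr, FreeGroup.lift_apply_of, htree e he])

variable (φ : ∀ a, 𝒢.vgrp a →* M) (τ : ∀ ⦃a b : V⦄, (a ⟶ b) → M)
    (hconj : ∀ ⦃a b : V⦄ (e : a ⟶ b) (x : 𝒢.egrp e),
      τ e * φ a (𝒢.minus e x) = φ b (𝒢.plus e x) * τ e)
    (htree : ∀ ⦃a b : V⦄ (e : a ⟶ b), e ∈ T a b → τ e = 1)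

@[simp]
theorem pi1Lift_ofV (a : V) (x : 𝒢.vgrp a) :
    𝒢.pi1Lift T φ τ hconj htree (𝒢.ofV T a x) = φ a x := by
  change Monoid.Coprod.lift (Monoid.CoprodI.lift φ) (FreeGroup.lift fun e : Quiver.Total V => τ e.hom)
    (Monoid.Coprod.inl (Monoid.CoprodI.of x)) = _
  rw [Monoid.Coprod.lift_apply_inl, Monoid.CoprodI.lift_of]

@[simp]
theorem pi1Lift_ofE {a b : V} (e : a ⟶ b) :
    𝒢.pi1Lift T φ τ hconj htree (𝒢.ofE T e) = τ e := by
  change Monoid.Coprod.lift (Monoid.CoprodI.lift φ) (FreeGroup.lift fun e : Quiver.Total V => τ e.hom)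
    (Monoid.Coprod.inr (FreeGroup.of _)) = _
  rw [Monoid.Coprod.lift_apply_inr, FreeGroup.lift_apply_of]

theorem pi1_hom_ext {f g : 𝒢.Pi1 T →* M} (hv : ∀ a x, f (𝒢.ofV T a x) = g (𝒢.ofV T a x))
    (he : ∀ ⦃a b : V⦄ (e : a ⟶ b), f (𝒢.ofE T e) = g (𝒢.ofE T e)) : f = g := by
  refine QuotientGroup.monoidHom_ext _ (Monoid.Coprod.hom_ext ?_ ?_)
  · refine Monoid.CoprodI.ext_hom _ _ fun a => ?_
    ext x
    exact hv a x
  · ext e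
    exact he e.hom

end UniversalProperty

theorem ofE_mul_ofV {a b : V} (e : a ⟶ b) (x : 𝒢.egrp e) :
    𝒢.ofE T e * 𝒢.ofV T a (𝒢.minus e x) = 𝒢.ofV T b (𝒢.plus e x) * 𝒢.ofE T e := by
  rw [← ofE_conj, inv_mul_cancel_right]

theorem ofE_of_mem {a b : V} (e : a ⟶ b) (he : e ∈ T a b) : 𝒢.ofE T e = 1 :=
  (QuotientGroup.eq_one_iff _).2 (Subgroup.subset_normalClosure (IsRelator.tree e he))

/-- The universal property gives a homomorphism into `S`; composed with the inclusion it fixes the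
generators, so it is the identity. -/
theorem mem_of_generators_mem (S : Subgroup (𝒢.Pi1 T)) (hv : ∀ a x, 𝒢.ofV T a x ∈ S)
    (he : ∀ ⦃a b : V⦄ (e : a ⟶ b), 𝒢.ofE T e ∈ S) (p : 𝒢.Pi1 T) : p ∈ S := by
  let f : 𝒢.Pi1 T →* S := 𝒢.pi1Lift T (fun a => (𝒢.ofV T a).codRestrict S (hv a))
    (fun a b e => ⟨𝒢.ofE T e, he e⟩)
    (fun a b e x => Subtype.ext (𝒢.ofE_mul_ofV T e x))
    (fun a b e h => Subtype.ext (𝒢.ofE_of_mem T e h))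
  have h : S.subtype.comp f = MonoidHom.id _ := by
    refine 𝒢.pi1_hom_ext T (fun a x => ?_) (fun a b e => ?_)
    · simp [f]
    · simp [f]
  have := DFunLike.congr_fun h p
  rw [MonoidHom.id_apply] at this
  rw [← this]
  exact (f p).2

variable {Q : Type} [Group Q] (ρ : ∀ ⦃a b : V⦄, (a ⟶ b) → Q)

/-- The pullback of a graph of groups to a derived graph. -/
def derived (h : GraphConnected (DerivedGraph ρ)) : GraphOfGroups.{w} (DerivedGraph ρ) where
  connected := h
  vgrp x := 𝒢.vgrp x.base
  egrp _ _ e := 𝒢.egrp e.1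
  minus _ _ e := 𝒢.minus e.1
  plus _ _ e := 𝒢.plus e.1
  minus_injective _ _ e := 𝒢.minus_injective e.1
  plus_injective _ _ e := 𝒢.plus_injective e.1

end GraphOfGroups

/-! ### Twisted translations -/

/-- Permutations of `Q × H` of the form `(g, h) ↦ (q * g, u g * h)`. -/
@[ext]
structure TwistedTranslation (Q H : Type*) where
  base : Q
  twist : Q → H

namespace TwistedTranslation

variable {Q H : Type*} [Group Q] [Group H]

instance : Mul (TwistedTranslation Q H) :=
  ⟨fun x y => ⟨x.base * y.base, fun g => x.twist (y.base * g) * y.twist g⟩⟩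
instance : One (TwistedTranslation Q H) := ⟨⟨1, fun _ => 1⟩⟩
instance : Inv (TwistedTranslation Q H) :=
  ⟨fun x => ⟨x.base⁻¹, fun g => (x.twist (x.base⁻¹ * g))⁻¹⟩⟩

@[simp] theorem mul_base (x y : TwistedTranslation Q H) : (x * y).base = x.base * y.base := rfl
@[simp] theorem mul_twist (x y : TwistedTranslation Q H) (g : Q) :
    (x * y).twist g = x.twist (y.base * g) * y.twist g := rfl
@[simp] theorem one_base : (1 : TwistedTranslation Q H).base = 1 := rfl
@[simp] theorem one_twist (g : Q) : (1 : TwistedTranslation Q H).twist g = 1 := rfl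
@[simp] theorem inv_base (x : TwistedTranslation Q H) : x⁻¹.base = x.base⁻¹ := rfl
@[simp] theorem inv_twist (x : TwistedTranslation Q H) (g : Q) :
    x⁻¹.twist g = (x.twist (x.base⁻¹ * g))⁻¹ := rfl

instance : Group (TwistedTranslation Q H) :=
  Group.ofLeftAxioms
    (fun x y z => by ext <;> simp [mul_assoc])
    (fun x => by ext <;> simp)
    (fun x => by ext <;> simp)

/-- The projection to the translations of `Q`. -/
def baseHom : TwistedTranslation Q H →* Q where
  toFun := base
  map_one' := rfl
  map_mul' _ _ := rfl

end TwistedTranslation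

/-! ### The kernel of the voltage homomorphism -/

namespace GraphOfGroups

variable {V : Type u} [Quiver.{v} V] (𝒢 : GraphOfGroups.{w} V) (T : WideSubquiver V)
  {Q : Type} [Group Q] (ρ : ∀ ⦃a b : V⦄, (a ⟶ b) → Q)

/-- The homomorphism to `Q` given by the voltages. -/
def voltageHom (hρ : ∀ ⦃a b : V⦄ (e : a ⟶ b), e ∈ T a b → ρ e = 1) : 𝒢.Pi1 T →* Q :=
  𝒢.pi1Lift T (fun _ => 1) ρ (fun a b e x => by simp) hρ

/-- The fundamental group of the pullback to a derived graph is isomorphic to the kernel of the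
voltage homomorphism. -/
theorem exists_derived_hom (hT : IsSpanningTree T)
    (hρ : ∀ ⦃a b : V⦄ (e : a ⟶ b), e ∈ T a b → ρ e = 1)
    (hc : GraphConnected (DerivedGraph ρ)) (S : WideSubquiver (DerivedGraph ρ))
    (hS : IsSpanningTree S) :
    ∃ (f : (𝒢.derived ρ hc).Pi1 S →* 𝒢.Pi1 T) (k : DerivedGraph ρ → 𝒢.Pi1 T),
      Function.Injective f ∧ f.range = (𝒢.voltageHom T ρ hρ).ker ∧
      (∀ x, 𝒢.voltageHom T ρ hρ (k x) = x.sheet⁻¹) ∧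
      (∀ (x : DerivedGraph ρ) (z : 𝒢.vgrp x.base), f ((𝒢.derived ρ hc).ofV S x z) =
        k x * 𝒢.ofV T x.base z * (k x)⁻¹) ∧
      (∀ ⦃x y⦄ (e : x ⟶ y), f ((𝒢.derived ρ hc).ofE S e) = k y * 𝒢.ofE T e.1 * (k x)⁻¹) := by
  obtain ⟨o⟩ := 𝒢.connected.1
  set ℋ := 𝒢.derived ρ hc with hℋ
  set χ := 𝒢.voltageHom T ρ hρ with hχ
  have χV : ∀ a x, χ (𝒢.ofV T a x) = 1 := fun a x => by simp [hχ, voltageHom]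
  have χE : ∀ {a b : V} (e : a ⟶ b), χ (𝒢.ofE T e) = ρ e := fun e => by simp [hχ, voltageHom]
  -- the images of the generators of the group on the derived graph
  obtain ⟨vH, hvH⟩ : ∃ vH : ∀ a, Q → (𝒢.vgrp a →* ℋ.Pi1 S),
      ∀ (x : DerivedGraph ρ) (z : 𝒢.vgrp x.base), ℋ.ofV S x z = vH x.base x.sheet z :=
    ⟨fun a g => ℋ.ofV S ⟨a, g⟩, fun x z => rfl⟩
  obtain ⟨eH, heH⟩ : ∃ eH : ∀ {a b : V}, (a ⟶ b) → Q → ℋ.Pi1 S,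
      ∀ {a b : V} (e : a ⟶ b) g, ℋ.ofE S (DerivedGraph.lift ρ e g) = eH e g :=
    ⟨fun e g => ℋ.ofE S (DerivedGraph.lift ρ e g), fun e g => rfl⟩
  have hrel : ∀ {a b : V} (e : a ⟶ b) (g : Q) (x : 𝒢.egrp e),
      eH e g * vH a g (𝒢.minus e x) = vH b (ρ e * g) (𝒢.plus e x) * eH e g := fun {a b} e g x => by
    rw [← heH]
    exact ((congrArg _ (hvH ⟨a, g⟩ (𝒢.minus e x))).symm.trans
      (ℋ.ofE_mul_ofV S (DerivedGraph.lift ρ e g) x)).trans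
      (congrArg (· * _) (hvH ⟨b, ρ e * g⟩ (𝒢.plus e x)))
  have hmem : ∀ {a b : V} (e : a ⟶ b) (g : Q), DerivedGraph.lift ρ e g ∈ S ⟨a, g⟩ ⟨b, ρ e * g⟩ →
      eH e g = 1 := fun e g h => by rw [← heH, ℋ.ofE_of_mem S _ h]
  have hgen : ∀ R : Subgroup (ℋ.Pi1 S), (∀ a g z, vH a g z ∈ R) →
      (∀ {a b : V} (e : a ⟶ b) g, eH e g ∈ R) → ∀ h, h ∈ R := fun R h1 h2 =>
    ℋ.mem_of_generators_mem S R (fun x z => by rw [hvH x z]; exact h1 _ _ _)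
      (DerivedGraph.hom_cases ρ fun e g => by rw [heH]; exact h2 e g)
  -- Conjugating by `k` will send the letters of edges in `S` to `1`, as the relations of the
  -- derived group demand.
  obtain ⟨k, hk1, hk⟩ := hS.exists_gauge (M := 𝒢.Pi1 T) (fun x y e => 𝒢.ofE T e.1) ⟨o, 1⟩
  -- Since `ρ` is trivial on `T`, the tree lifts to every sheet; `s g` is a gauge along the lift to
  -- the sheet `g`.
  choose s hs1 hs using fun g : Q => hT.exists_gauge (M := ℋ.Pi1 S) (fun a b e => eH e g) o
  have χk : ∀ x, χ (k x) = x.sheet⁻¹ := by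
    intro x
    rw [eq_inv_iff_mul_eq_one]
    have := hS.const_of_edges (fun x => χ (k x) * x.sheet) (fun x y e he => by
      rw [← hk e he, map_mul, χE, mul_assoc, e.2]) x ⟨o, 1⟩
    simpa [hk1] using this
  have χk' : ∀ a g, χ (k ⟨a, g⟩) = g⁻¹ := fun a g => χk ⟨a, g⟩
  obtain ⟨f, fV, fE⟩ : ∃ f : ℋ.Pi1 S →* 𝒢.Pi1 T,
      (∀ a g z, f (vH a g z) = k ⟨a, g⟩ * 𝒢.ofV T a z * (k ⟨a, g⟩)⁻¹) ∧
      (∀ {a b : V} (e : a ⟶ b) g, f (eH e g) = k ⟨b, ρ e * g⟩ * 𝒢.ofE T e * (k ⟨a, g⟩)⁻¹) := by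
    let f : ℋ.Pi1 S →* 𝒢.Pi1 T := ℋ.pi1Lift S
      (fun x => (MulAut.conj (k x)).toMonoidHom.comp (𝒢.ofV T x.base))
      (fun x y e => k y * 𝒢.ofE T e.1 * (k x)⁻¹)
      (fun x y e z => by
        change 𝒢.egrp e.1 at z
        change k y * 𝒢.ofE T e.1 * (k x)⁻¹ * (k x * 𝒢.ofV T x.base (𝒢.minus e.1 z) * (k x)⁻¹) =
          k y * 𝒢.ofV T y.base (𝒢.plus e.1 z) * (k y)⁻¹ * (k y * 𝒢.ofE T e.1 * (k x)⁻¹)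
        simp only [mul_assoc, inv_mul_cancel_left]
        rw [← mul_assoc (𝒢.ofE T e.1), 𝒢.ofE_mul_ofV, mul_assoc])
      (fun x y e he => by rw [hk e he, mul_inv_cancel])
    refine ⟨f, fun a g z => ?_, fun {a b} e g => ?_⟩
    · rw [← hvH ⟨a, g⟩ z]
      exact ℋ.pi1Lift_ofV S _ _ _ _ ⟨a, g⟩ z
    · rw [← heH]
      exact ℋ.pi1Lift_ofE S _ _ _ _ (DerivedGraph.lift ρ e g)
  -- `G` acts on `Q × H`: on the sheet `g`, a generator acts by its lift starting there, transported
  -- along the lifted trees to the vertices over `o`. The twist at the sheet `1` will invert `f`.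
  obtain ⟨A, AV, AE⟩ : ∃ A : 𝒢.Pi1 T →* TwistedTranslation Q (ℋ.Pi1 S),
      (∀ a (x : 𝒢.vgrp a), A (𝒢.ofV T a x) = ⟨1, fun g => s g a * vH a g x * (s g a)⁻¹⟩) ∧
      (∀ {a b : V} (e : a ⟶ b), A (𝒢.ofE T e) =
        ⟨ρ e, fun g => s (ρ e * g) b * eH e g * (s g a)⁻¹⟩) := by
    let A := 𝒢.pi1Lift (M := TwistedTranslation Q (ℋ.Pi1 S)) T
      (fun a => MonoidHom.mk' (fun x => ⟨1, fun g => s g a * vH a g x * (s g a)⁻¹⟩)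
        (fun x y => by ext g <;> simp [mul_assoc]))
      (fun a b e => ⟨ρ e, fun g => s (ρ e * g) b * eH e g * (s g a)⁻¹⟩)
      (fun a b e x => by
        ext g
        · simp
        · simp only [TwistedTranslation.mul_twist, MonoidHom.mk'_apply, one_mul, mul_assoc,
            inv_mul_cancel_left]
          rw [← mul_assoc (eH _ _), hrel, mul_assoc])
      (fun a b e he => by
        ext g
        · exact hρ e he
        · simp [hρ e he, hs g e he])
    exact ⟨A, fun a x => 𝒢.pi1Lift_ofV T _ _ _ _ a x, fun e => 𝒢.pi1Lift_ofE T _ _ _ _ e⟩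
  have Aχ : ∀ p, (A p).base = χ p := by
    intro p
    have : TwistedTranslation.baseHom.comp A = χ := by
      refine 𝒢.pi1_hom_ext T (fun a x => ?_) (fun a b e => ?_)
      · rw [χV, MonoidHom.comp_apply, AV]
        rfl
      · rw [χE, MonoidHom.comp_apply, AE]
        rfl
    exact DFunLike.congr_fun this p
  have Amul : ∀ p q g, (A (p * q)).twist g = (A p).twist (χ q * g) * (A q).twist g := by
    intro p q g
    rw [map_mul, TwistedTranslation.mul_twist, Aχ]
  have Ainv : ∀ p g, (A p⁻¹).twist g = ((A p).twist ((χ p)⁻¹ * g))⁻¹ := by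
    intro p g
    rw [map_inv, TwistedTranslation.inv_twist, Aχ]
  -- The product with `s g a` is unchanged across edges of `S` and equals `1` at `(o, 1)`.
  have hAk : ∀ a g, (A (k ⟨a, g⟩)).twist g = (s g a)⁻¹ := by
    intro a g
    rw [eq_inv_iff_mul_eq_one]
    have := hS.const_of_edges (fun x => (A (k x)).twist x.sheet * s x.sheet x.base) ?_
      ⟨a, g⟩ ⟨o, 1⟩
    · simpa [hk1, hs1] using this
    · refine DerivedGraph.hom_cases ρ fun {a b} e g he => ?_
      have h1 : k ⟨b, ρ e * g⟩ * 𝒢.ofE T e = k ⟨a, g⟩ := hk _ he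
      change (A (k ⟨a, g⟩)).twist g * s g a = (A (k ⟨b, ρ e * g⟩)).twist (ρ e * g) * s (ρ e * g) b
      rw [← h1, Amul, χE, AE]
      simp [hmem e g he, mul_assoc]
  have χf : ∀ h, χ (f h) = 1 := by
    refine hgen (χ.comp f).ker (fun a g z => ?_) (fun e g => ?_)
    · simp [MonoidHom.mem_ker, fV, χV]
    · simp [MonoidHom.mem_ker, fE, χE, χk']
  -- As `χ ∘ f` is trivial, the twist at `1` is multiplicative along `f`, so generators suffice.
  -- This gives injectivity of `f`.
  have Af : ∀ h, (A (f h)).twist 1 = h := by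
    let B : ℋ.Pi1 S →* ℋ.Pi1 S := MonoidHom.mk' (fun h => (A (f h)).twist 1)
        (fun h h' => by rw [map_mul, Amul, χf, one_mul])
    refine hgen (B.eqLocus (MonoidHom.id _)) (fun a g z => ?_) (fun {a b} e g => ?_)
    · change (A (f (vH a g z))).twist 1 = vH a g z
      rw [fV, Amul, Amul, Ainv, map_inv, χk', inv_inv, mul_one, χV, one_mul, hAk, AV]
      simp [mul_assoc]
    · change (A (f (eH e g))).twist 1 = eH e g
      rw [fE, Amul, Amul, Ainv, map_inv, χk', inv_inv, mul_one, χE, hAk, hAk, AE]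
      simp [mul_assoc]
  have fs : ∀ g a, f (s g a) * k ⟨a, g⟩ = k ⟨o, g⟩ := by
    intro g a
    have := hT.const_of_edges (fun a => f (s g a) * k ⟨a, g⟩) (fun a b e he => by
      rw [← hs g e he, map_mul, fE, hρ e he, 𝒢.ofE_of_mem T e he]
      simp [mul_assoc]) a o
    simpa [hs1] using this
  have fA : ∀ p g, f ((A p).twist g) = k ⟨o, χ p * g⟩ * p * (k ⟨o, g⟩)⁻¹ := by
    intro p
    -- All sheets are treated at once because multiplication moves the sheet. For `p` in the kernel
    -- and `g = 1`, where `k ⟨o, 1⟩ = 1`, the identity exhibits `p` as a value of `f`.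
    let R : Subgroup (𝒢.Pi1 T) :=
      { carrier := {p | ∀ g, f ((A p).twist g) = k ⟨o, χ p * g⟩ * p * (k ⟨o, g⟩)⁻¹}
        one_mem' := fun g => by simp
        mul_mem' := fun {p q} hp hq g => by
          rw [Amul, map_mul, hp, hq, map_mul]
          simp [mul_assoc]
        inv_mem' := fun {p} hp g => by
          rw [Ainv, map_inv, hp, map_inv]
          simp [mul_assoc] }
    refine 𝒢.mem_of_generators_mem T R (fun a x g => ?_) (fun a b e g => ?_) p
    · rw [AV, χV, one_mul, ← fs g a]
      simp [mul_assoc, fV]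
    · rw [AE, χE, ← fs g a, ← fs (ρ e * g) b]
      simp [mul_assoc, fE]
  refine ⟨f, k, fun h h' hh => by rw [← Af h, hh, Af], ?_, χk,
    fun x z => by rw [hvH x z]; exact fV _ _ _,
    DerivedGraph.hom_cases ρ fun e g => by rw [heH]; exact fE e g⟩
  ext p
  constructor
  · rintro ⟨h, rfl⟩
    exact χf h
  · intro hp
    exact ⟨(A p).twist 1, by rw [fA, MonoidHom.mem_ker.1 hp, mul_one, hk1]; simp⟩

end GraphOfGroups

/-! ### Comparison of the Bass–Serre trees -/

namespace GraphOfGroups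

variable {V : Type u} [Quiver.{v} V] (𝒢 : GraphOfGroups.{w} V) (T : WideSubquiver V)
  {Q : Type} [Group Q] (ρ : ∀ ⦃a b : V⦄, (a ⟶ b) → Q)

/-- The splitting of the fundamental group of the pullback to a derived graph is the induced one. -/
theorem isInducedSplitting_derived
    (hρ : ∀ ⦃a b : V⦄ (e : a ⟶ b), e ∈ T a b → ρ e = 1)
    (hc : GraphConnected (DerivedGraph ρ)) (S : WideSubquiver (DerivedGraph ρ))
    (f : (𝒢.derived ρ hc).Pi1 S →* 𝒢.Pi1 T) (k : DerivedGraph ρ → 𝒢.Pi1 T)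
    (finj : Function.Injective f) (frange : f.range = (𝒢.voltageHom T ρ hρ).ker)
    (χk : ∀ x, 𝒢.voltageHom T ρ hρ (k x) = x.sheet⁻¹)
    (fV : ∀ (x : DerivedGraph ρ) (z : 𝒢.vgrp x.base), f ((𝒢.derived ρ hc).ofV S x z) =
        k x * 𝒢.ofV T x.base z * (k x)⁻¹)
    (fE : ∀ ⦃x y⦄ (e : x ⟶ y), f ((𝒢.derived ρ hc).ofE S e) = k y * 𝒢.ofE T e.1 * (k x)⁻¹) :
    𝒢.IsInducedSplitting T (𝒢.derived ρ hc) S f := by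
  have χV : ∀ a x, 𝒢.voltageHom T ρ hρ (𝒢.ofV T a x) = 1 := fun a x => by simp [voltageHom]
  have χf : ∀ h, 𝒢.voltageHom T ρ hρ (f h) = 1 := fun h => by
    rw [← MonoidHom.mem_ker, ← frange]
    exact ⟨h, rfl⟩
  -- As `χ (k ⟨a, g⟩) = g⁻¹`, the sheet `g = (χ p)⁻¹` is the one for which `p * (k ⟨a, g⟩)⁻¹` lies
  -- in the kernel, hence in the range of `f`.
  have fsurj : ∀ (a : V) (p : 𝒢.Pi1 T), ∃ g h, f h * k ⟨a, g⟩ = p := fun a p => by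
    have : p * (k ⟨a, (𝒢.voltageHom T ρ hρ p)⁻¹⟩)⁻¹ ∈ f.range := by
      rw [frange, MonoidHom.mem_ker, map_mul, map_inv, χk]
      simp
    obtain ⟨h, hh⟩ := this
    exact ⟨_, h, by rw [hh, inv_mul_cancel_right]⟩
  have key : ∀ (x : DerivedGraph ρ) (h h' : (𝒢.derived ρ hc).Pi1 S) (z : 𝒢.vgrp x.base),
      (𝒢.derived ρ hc).ofV S x z = h⁻¹ * h' → 𝒢.ofV T x.base z = (f h * k x)⁻¹ * (f h' * k x) := by
    intro x h h' z hz
    have h1 := fV x z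
    rw [hz, map_mul, map_inv] at h1
    calc 𝒢.ofV T x.base z = (k x)⁻¹ * (k x * 𝒢.ofV T x.base z * (k x)⁻¹) * k x := by group
      _ = (f h * k x)⁻¹ * (f h' * k x) := by rw [← h1]; group
  have key' : ∀ (x : DerivedGraph ρ) (h h' : (𝒢.derived ρ hc).Pi1 S) (z : 𝒢.vgrp x.base),
      𝒢.ofV T x.base z = (f h * k x)⁻¹ * (f h' * k x) → (𝒢.derived ρ hc).ofV S x z = h⁻¹ * h' := by
    intro x h h' z hz
    apply finj
    refine (fV x z).trans ?_
    rw [hz, map_mul, map_inv]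
    group
  -- `χ` kills the vertex groups and the image of `f`, so a coset over `a` remembers its sheet: the
  -- sheets index the orbits over `a`.
  have sheet : ∀ (a : V) (g g' : Q) (h h' : (𝒢.derived ρ hc).Pi1 S) (z : 𝒢.vgrp a),
      𝒢.ofV T a z = (f h * k ⟨a, g⟩)⁻¹ * (f h' * k ⟨a, g'⟩) → g = g' := by
    intro a g g' h h' z hz
    have := congrArg (𝒢.voltageHom T ρ hρ) hz
    rw [χV, map_mul, map_inv, map_mul, map_mul, χf, χf, χk, χk] at this
    simpa [eq_comm, mul_inv_eq_one] using this
  -- The stabilizers upstairs are conjugates by `k` of vertex groups, so right multiplication by `k`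
  -- turns their cosets into cosets of the vertex groups.
  let αV : (𝒢.derived ρ hc).BassSerreV S → 𝒢.BassSerreV T := fun v =>
    ⟨v.1.base, Quotient.liftOn' v.2
      (fun h => ((f h * k v.1 : 𝒢.Pi1 T) : 𝒢.Pi1 T ⧸ (𝒢.ofV T v.1.base).range)) (by
        intro h h' hh
        rw [QuotientGroup.leftRel_apply] at hh
        obtain ⟨z, hz⟩ := hh
        exact QuotientGroup.eq.2 ⟨z, key _ h h' z hz⟩)⟩
  let αE : (𝒢.derived ρ hc).BassSerreE S → 𝒢.BassSerreE T := fun ε =>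
    ⟨⟨ε.1.left.base, ε.1.right.base, ε.1.hom.1⟩, Quotient.liftOn' ε.2
      (fun h => ((f h * k ε.1.left : 𝒢.Pi1 T) :
        𝒢.Pi1 T ⧸ ((𝒢.ofV T ε.1.left.base).comp (𝒢.minus ε.1.hom.1)).range)) (by
        intro h h' hh
        rw [QuotientGroup.leftRel_apply] at hh
        obtain ⟨z, hz⟩ := hh
        exact QuotientGroup.eq.2 ⟨z, key _ h h' _ hz⟩)⟩
  have αV_bij : Function.Bijective αV := by
    constructor
    · rintro ⟨⟨a, g⟩, c⟩ ⟨⟨a', g'⟩, c'⟩ heq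
      obtain rfl : a = a' := congrArg Sigma.fst heq
      induction c using QuotientGroup.induction_on with | H h => ?_
      induction c' using QuotientGroup.induction_on with | H h' => ?_
      obtain ⟨z, hz⟩ := QuotientGroup.eq.1 (eq_of_heq (Sigma.mk.inj heq).2)
      obtain rfl := sheet _ _ _ _ _ z hz
      exact congrArg (Sigma.mk _) (QuotientGroup.eq.2 ⟨z, key' _ h h' z hz⟩)
    · rintro ⟨a, c⟩
      induction c using QuotientGroup.induction_on with | H p => ?_
      obtain ⟨g, h, rfl⟩ := fsurj a p
      exact ⟨⟨⟨a, g⟩, (h : (𝒢.derived ρ hc).Pi1 S)⟩, rfl⟩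
  have αE_bij : Function.Bijective αE := by
    constructor
    · suffices h : ∀ ⦃x y : DerivedGraph ρ⦄ (e : x ⟶ y) ⦃x' y' : DerivedGraph ρ⦄ (e' : x' ⟶ y')
          c c', αE ⟨⟨x, y, e⟩, c⟩ = αE ⟨⟨x', y', e'⟩, c'⟩ →
          (⟨⟨x, y, e⟩, c⟩ : (𝒢.derived ρ hc).BassSerreE S) = ⟨⟨x', y', e'⟩, c'⟩ from
        fun ⟨⟨_, _, e⟩, c⟩ ⟨⟨_, _, e'⟩, c'⟩ heq => h e e' c c' heq
      refine DerivedGraph.hom_cases ρ fun {a b} e g => ?_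
      refine DerivedGraph.hom_cases ρ fun {a' b'} e' g' c c' heq => ?_
      have h1 : (⟨a, b, e⟩ : Quiver.Total V) = ⟨a', b', e'⟩ := congrArg Sigma.fst heq
      cases h1
      induction c using QuotientGroup.induction_on with | H h => ?_
      induction c' using QuotientGroup.induction_on with | H h' => ?_
      obtain ⟨z, hz⟩ := QuotientGroup.eq.1 (eq_of_heq (Sigma.mk.inj heq).2)
      obtain rfl := sheet _ _ _ _ _ _ hz
      exact congrArg (Sigma.mk _) (QuotientGroup.eq.2 ⟨z, key' _ h h' _ hz⟩)
    · rintro ⟨⟨a, b, e⟩, c⟩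
      induction c using QuotientGroup.induction_on with | H p => ?_
      obtain ⟨g, h, rfl⟩ := fsurj a p
      exact ⟨⟨⟨⟨a, g⟩, ⟨b, ρ e * g⟩, DerivedGraph.lift ρ e g⟩, (h : (𝒢.derived ρ hc).Pi1 S)⟩, rfl⟩
  refine ⟨Equiv.ofBijective αV αV_bij, Equiv.ofBijective αE αE_bij, ?_, ?_, ?_, ?_⟩
  · rintro h ⟨x, c⟩
    induction c using QuotientGroup.induction_on with | H h' => ?_
    have h1 : f (h * h') * k x = f h * (f h' * k x) := by rw [map_mul, mul_assoc]
    exact congrArg (fun p : 𝒢.Pi1 T => (⟨x.base, (p : 𝒢.Pi1 T ⧸ _)⟩ : 𝒢.BassSerreV T)) h1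
  · rintro h ⟨⟨x, y, e⟩, c⟩
    induction c using QuotientGroup.induction_on with | H h' => ?_
    have h1 : f (h * h') * k x = f h * (f h' * k x) := by rw [map_mul, mul_assoc]
    exact congrArg (fun p : 𝒢.Pi1 T =>
      (⟨⟨x.base, y.base, e.1⟩, (p : 𝒢.Pi1 T ⧸ _)⟩ : 𝒢.BassSerreE T)) h1
  · rintro ⟨⟨x, y, e⟩, c⟩
    induction c using QuotientGroup.induction_on with | H h' => ?_
    rfl
  · rintro ⟨⟨x, y, e⟩, c⟩
    induction c using QuotientGroup.induction_on with | H h' => ?_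
    -- The factors `k y` cancel, so the shift by the inverse letter that defines terminal vertices
    -- is the same in both trees.
    have h1 : f (h' * ((𝒢.derived ρ hc).ofE S e)⁻¹) * k y = f h' * k x * (𝒢.ofE T e.1)⁻¹ := by
      rw [map_mul, map_inv, fE]
      group
    have h2 := congrArg (fun p : 𝒢.Pi1 T =>
      (⟨y.base, (p : 𝒢.Pi1 T ⧸ (𝒢.ofV T y.base).range)⟩ : 𝒢.BassSerreV T)) h1
    exact h2

/-- A graph of groups with trivial monodromy has constant vertex groups. -/
theorem LocallyConstant.hasConstantVertexGroups {𝒢 : GraphOfGroups.{w} V} (Θ : 𝒢.LocallyConstant)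
    (a : V) (h : Θ.monodromyGroup a = ⊥) : 𝒢.HasConstantVertexGroups := by
  have h' : (monodromyHom (fun b => GrpCat.of (𝒢.vgrp b))
    (fun _ _ e => (Θ.iso e).toGrpIso) a).range = ⊥ := h
  have key := exists_trivialization (fun b => GrpCat.of (𝒢.vgrp b))
    (fun _ _ e => (Θ.iso e).toGrpIso) 𝒢.connected a
  obtain ⟨ψ, hψ⟩ := key h'
  refine ⟨𝒢.vgrp a, inferInstance, fun b => (ψ b).groupIsoToMulEquiv, fun b c e x => ?_⟩
  have h1 : (ψ b).hom (𝒢.minus e x) = (ψ c).hom (Θ.iso e (𝒢.minus e x)) := by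
    rw [← hψ e]
    rfl
  rw [Θ.iso_minus] at h1
  exact h1

/-- Finite monodromy: a finite index subgroup has an induced splitting with constant vertex
groups. -/
theorem LocallyConstant.exists_finiteIndex {𝒢 : GraphOfGroups.{w} V} (Θ : 𝒢.LocallyConstant)
    (hT : IsSpanningTree T) {G : Type*} [Group G] (splitG : G ≃* 𝒢.Pi1 T)
    (a : V) (h : Finite (Θ.monodromyGroup a)) :
    ∃ G' : Subgroup G, G'.FiniteIndex ∧
      ∃ (V' : Type u) (_ : Quiver.{v} V') (𝒢' : GraphOfGroups.{w} V')
        (T' : WideSubquiver V') (_ : IsSpanningTree T') (splitG' : G' ≃* 𝒢'.Pi1 T'),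
        𝒢'.HasConstantVertexGroups ∧
        𝒢.IsInducedSplitting T 𝒢' T'
          ((splitG.toMonoidHom.comp G'.subtype).comp splitG'.symm.toMonoidHom) := by
  -- Paths inside the tree make the voltages trivial on `T`, which the voltage homomorphism
  -- requires.
  obtain ⟨p, hp⟩ := hT.exists_paths a
  have : Finite (monodromyHom (fun b => GrpCat.of (𝒢.vgrp b))
    (fun _ _ e => (Θ.iso e).toGrpIso) a).range := h
  obtain ⟨Q, _, _, ρ, hρ, hc, ψ, hψ⟩ := exists_derived_trivialization
    (fun b => GrpCat.of (𝒢.vgrp b)) (fun _ _ e => (Θ.iso e).toGrpIso) p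
  have hρT : ∀ ⦃b c : V⦄ (e : b ⟶ c), e ∈ T b c → ρ e = 1 := fun b c e he => hρ e (hp e he)
  obtain ⟨S, hS⟩ := hc.exists_isSpanningTree
  obtain ⟨f, k, finj, frange, χk, fV, fE⟩ := 𝒢.exists_derived_hom T ρ hT hρT hc S hS
  let G' : Subgroup G := ((𝒢.voltageHom T ρ hρT).comp splitG.toMonoidHom).ker
  have hmem : ∀ h, splitG.symm (f h) ∈ G' := fun h => by
    change 𝒢.voltageHom T ρ hρT (splitG (splitG.symm (f h))) = 1
    rw [MulEquiv.apply_symm_apply, ← MonoidHom.mem_ker, ← frange]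
    exact ⟨h, rfl⟩
  let s : (𝒢.derived ρ hc).Pi1 S ≃* G' := MulEquiv.ofBijective
    ((splitG.symm.toMonoidHom.comp f).codRestrict G' hmem) (by
      constructor
      · intro h h' hh
        exact finj (splitG.symm.injective (Subtype.ext_iff.1 hh))
      · rintro ⟨g, hg⟩
        have : splitG g ∈ f.range := by
          rw [frange]
          exact hg
        obtain ⟨h, hh⟩ := this
        refine ⟨h, Subtype.ext ?_⟩
        change splitG.symm (f h) = g
        rw [hh, MulEquiv.symm_apply_apply])
  refine ⟨G', Subgroup.finiteIndex_ker _, DerivedGraph ρ, inferInstance, 𝒢.derived ρ hc, S, hS,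
    s.symm, ?_, ?_⟩
  · refine ⟨𝒢.vgrp a, inferInstance, fun x => (ψ x).groupIsoToMulEquiv, fun x y e z => ?_⟩
    change 𝒢.egrp e.1 at z
    have h1 : (ψ x).hom (𝒢.minus e.1 z) = (ψ y).hom (Θ.iso e.1 (𝒢.minus e.1 z)) := by
      rw [← hψ e]
      rfl
    rw [Θ.iso_minus] at h1
    exact h1
  · have hf : (splitG.toMonoidHom.comp G'.subtype).comp s.symm.symm.toMonoidHom = f := by
      exact MonoidHom.ext fun h => splitG.apply_symm_apply (f h)
    rw [hf]
    exact 𝒢.isInducedSplitting_derived T ρ hρT hc S f k finj frange χk fV fE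

end GraphOfGroups

/-! ### Coverings of total spaces -/

theorem CubeComplex.Hom.toMap_id (X : CubeComplex.{w}) (x : X.Space) :
    CubeComplex.Hom.toMap (𝟙 X) x = x := by
  induction x using Quot.ind
  rfl

theorem CubeComplex.Hom.continuous_toMap {X Y : CubeComplex.{w}} (f : X ⟶ Y) :
    Continuous (CubeComplex.Hom.toMap f) := by
  refine continuous_quot_lift _ (continuous_quot_mk.comp ?_)
  exact continuous_sigma fun c => 
    @continuous_sigmaMk _ (fun c : (Σ n, Y.cube n) => (Fin c.1 → I)) _
      ⟨c.1, CubeComplex.Hom.app f c.2⟩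

namespace GraphOfCubeComplexes

section TotalSpace

variable {V : Type u} [Quiver.{v} V] (𝒳 : GraphOfCubeComplexes.{w} V)

/-- A point of a piece, as a point of the total space. -/
def toTotal (z : 𝒳.Pieces) : 𝒳.TotalSpace := Quot.mk _ z

theorem isQuotientMap_toTotal : Topology.IsQuotientMap 𝒳.toTotal := isQuotientMap_quot_mk

theorem toTotal_surjective : Function.Surjective 𝒳.toTotal := Quot.mk_surjective

/-- The open star of a vertex. -/
def starPred (a : V) : 𝒳.Pieces → Prop
  | Sum.inl x => x.1 = a
  | Sum.inr x => (x.1.left = a ∧ (x.2.2 : ℝ) < 1 / 2) ∨ (x.1.right = a ∧ 1 / 2 < (x.2.2 : ℝ))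

/-- The interior of a thickened edge space. -/
def edgePred (e : Quiver.Total V) : 𝒳.Pieces → Prop
  | Sum.inl _ => False
  | Sum.inr x => x.1 = e ∧ 0 < (x.2.2 : ℝ) ∧ (x.2.2 : ℝ) < 1

/-- A property of the points of the pieces that respects the gluing. -/
def openSet (P : 𝒳.Pieces → Prop) : Set 𝒳.TotalSpace := {x | ∃ z, 𝒳.toTotal z = x ∧ P z}

/-- An invariant predicate descends to the quotient, so one representative decides membership. -/
theorem mem_openSet {P : 𝒳.Pieces → Prop} (h : ∀ z z', 𝒳.Glue z z' → (P z ↔ P z'))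
    (z : 𝒳.Pieces) : 𝒳.toTotal z ∈ 𝒳.openSet P ↔ P z := by
  refine ⟨?_, fun hz => ⟨z, rfl, hz⟩⟩
  rintro ⟨z', hz', hP⟩
  have key := congrArg (Quot.lift P fun a b hab => propext (h a b hab)) hz'
  exact key.mp hP

theorem starPred_glue (a : V) (z z' : 𝒳.Pieces) (h : 𝒳.Glue z z') :
    𝒳.starPred a z ↔ 𝒳.starPred a z' := by
  rcases h with ⟨e, x⟩ | ⟨e, x⟩
  · simp only [starPred, Set.Icc.coe_zero]
    norm_num
  · simp only [starPred, Set.Icc.coe_one]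
    norm_num

theorem edgePred_glue (e : Quiver.Total V) (z z' : 𝒳.Pieces) (h : 𝒳.Glue z z') :
    𝒳.edgePred e z ↔ 𝒳.edgePred e z' := by
  rcases h with ⟨e, x⟩ | ⟨e, x⟩ <;> simp [edgePred]

theorem isOpen_openSet {P : 𝒳.Pieces → Prop} (h : ∀ z z', 𝒳.Glue z z' → (P z ↔ P z'))
    (hl : ∀ a, IsOpen {x | P (Sum.inl ⟨a, x⟩)}) (hr : ∀ e, IsOpen {x | P (Sum.inr ⟨e, x⟩)}) :
    IsOpen (𝒳.openSet P) := by
  rw [← 𝒳.isQuotientMap_toTotal.isOpen_preimage]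
  have : 𝒳.toTotal ⁻¹' 𝒳.openSet P = {z | P z} := Set.ext fun z => 𝒳.mem_openSet h z
  rw [this, isOpen_sum_iff, isOpen_sigma_iff, isOpen_sigma_iff]
  exact ⟨hl, hr⟩

theorem isOpen_star (a : V) : IsOpen (𝒳.openSet (𝒳.starPred a)) := by
  refine 𝒳.isOpen_openSet (𝒳.starPred_glue a) 
    (fun b => (isOpen_const : IsOpen {_x : (𝒳.vsp b).Space | b = a})) fun e => ?_
  have h1 : Continuous fun x : (𝒳.esp e.hom).Space × I => (x.2 : ℝ) := by fun_prop
  have h2 : IsOpen {_x : (𝒳.esp e.hom).Space × I | e.left = a} := isOpen_const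
  have h3 : IsOpen {_x : (𝒳.esp e.hom).Space × I | e.right = a} := isOpen_const
  exact (h2.inter (isOpen_lt h1 continuous_const)).union
    (h3.inter (isOpen_lt continuous_const h1))

theorem isOpen_edge (e : Quiver.Total V) : IsOpen (𝒳.openSet (𝒳.edgePred e)) := by
  refine 𝒳.isOpen_openSet (𝒳.edgePred_glue e) 
    (fun b => (isOpen_const : IsOpen {_x : (𝒳.vsp b).Space | False})) fun e' => ?_
  have h1 : Continuous fun x : (𝒳.esp e'.hom).Space × I => (x.2 : ℝ) := by fun_prop
  have h2 : IsOpen {_x : (𝒳.esp e'.hom).Space × I | e' = e} := isOpen_const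
  exact h2.inter ((isOpen_lt continuous_const h1).inter (isOpen_lt h1 continuous_const))

/-- The open stars and the interiors of the thickened edge spaces cover the total space. -/
theorem star_or_edge (z : 𝒳.Pieces) : (∃ a, 𝒳.starPred a z) ∨ ∃ e, 𝒳.edgePred e z := by
  rcases z with ⟨a, x⟩ | ⟨e, x, t⟩
  · exact Or.inl ⟨a, rfl⟩
  · rcases lt_trichotomy (t : ℝ) (1 / 2) with h | h | h
    · exact Or.inl ⟨e.left, Or.inl ⟨rfl, h⟩⟩
    · refine Or.inr ⟨e, rfl, ?_⟩
      rw [h]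
      norm_num
    · exact Or.inl ⟨e.right, Or.inr ⟨rfl, h⟩⟩

end TotalSpace

/-! ### Deck transformations of the pulled back total space -/

section Derived

variable {V : Type u} [Quiver.{v} V] (𝒳 : GraphOfCubeComplexes.{w} V)
  {Q : Type} [Group Q] (ρ : ∀ ⦃a b : V⦄, (a ⟶ b) → Q)

/-- The pullback of a graph of cube complexes to a derived graph. -/
def derived (h : GraphConnected (DerivedGraph ρ)) :
    GraphOfCubeComplexes.{w} (DerivedGraph ρ) where
  connected := h
  vsp x := 𝒳.vsp x.base
  vsp_npc x := 𝒳.vsp_npc x.base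
  vsp_connected x := 𝒳.vsp_connected x.base
  esp _ _ e := 𝒳.esp e.1
  esp_npc _ _ e := 𝒳.esp_npc e.1
  esp_connected _ _ e := 𝒳.esp_connected e.1
  minus _ _ e := 𝒳.minus e.1
  plus _ _ e := 𝒳.plus e.1
  minus_localIsometry _ _ e := 𝒳.minus_localIsometry e.1
  plus_localIsometry _ _ e := 𝒳.plus_localIsometry e.1

variable (h : GraphConnected (DerivedGraph ρ))

/-- The projection of the pullback. -/
def derivedProj : Hom (𝒳.derived ρ h) 𝒳 where
  base := { obj := fun x => x.base, map := fun e => e.1 }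
  vmap x := 𝟙 (𝒳.vsp x.base)
  emap _ _ e := 𝟙 (𝒳.esp e.1)
  minus_vmap _ _ _ := rfl
  plus_vmap _ _ _ := rfl

/-- The lift of a point of a piece to the sheet `g`. -/
def liftPiece (g : Q) : 𝒳.Pieces → (𝒳.derived ρ h).Pieces
  | Sum.inl x => Sum.inl ⟨⟨x.1, g⟩, x.2⟩
  | Sum.inr x => Sum.inr ⟨⟨_, _, DerivedGraph.lift ρ x.1.hom g⟩, x.2⟩

/-- The lift of a point of a piece to the sheet `g`, as a point of the total space. -/
def liftPt (g : Q) (z : 𝒳.Pieces) : (𝒳.derived ρ h).TotalSpace :=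
  (𝒳.derived ρ h).toTotal (𝒳.liftPiece ρ h g z)

theorem exists_liftPiece (y : (𝒳.derived ρ h).Pieces) : ∃ g z, 𝒳.liftPiece ρ h g z = y := by
  rcases y with ⟨⟨a, g⟩, x⟩ | ⟨⟨x, y, e⟩, p⟩
  · exact ⟨g, Sum.inl ⟨a, x⟩, rfl⟩
  · have key : ∀ ⦃x y : DerivedGraph ρ⦄ (e : x ⟶ y) (p : (𝒳.esp e.1).Space × I),
        ∃ g z, 𝒳.liftPiece ρ h g z = Sum.inr ⟨⟨x, y, e⟩, p⟩ :=
      DerivedGraph.hom_cases ρ fun {a b} e g p => ⟨g, Sum.inr ⟨⟨a, b, e⟩, p⟩, rfl⟩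
    exact key e p

theorem exists_liftPt (y : (𝒳.derived ρ h).TotalSpace) : ∃ g z, 𝒳.liftPt ρ h g z = y := by
  obtain ⟨y, rfl⟩ := (𝒳.derived ρ h).toTotal_surjective y
  obtain ⟨g, z, rfl⟩ := 𝒳.exists_liftPiece ρ h y
  exact ⟨g, z, rfl⟩

theorem continuous_liftPiece (g : Q) : Continuous (𝒳.liftPiece ρ h g) := by
  refine continuous_sum_dom.2 ⟨?_, ?_⟩
  · refine continuous_inl.comp (continuous_sigma fun a => ?_)
    exact @continuous_sigmaMk _ (fun x : DerivedGraph ρ => (𝒳.vsp x.base).Space) _ ⟨a, g⟩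
  · refine continuous_inr.comp (continuous_sigma fun e => ?_)
    exact @continuous_sigmaMk _ (fun e : Quiver.Total (DerivedGraph ρ) =>
      (𝒳.esp e.hom.1).Space × I) _ ⟨_, _, DerivedGraph.lift ρ e.hom g⟩

theorem continuous_liftPt (g : Q) : Continuous (𝒳.liftPt ρ h g) :=
  (𝒳.derived ρ h).isQuotientMap_toTotal.continuous.comp (𝒳.continuous_liftPiece ρ h g)

theorem totalMap_liftPt (g : Q) (z : 𝒳.Pieces) :
    (𝒳.derivedProj ρ h).totalMap (𝒳.liftPt ρ h g z) = 𝒳.toTotal z := by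
  rcases z with ⟨a, x⟩ | ⟨e, x, t⟩
  · have : CubeComplex.Hom.toMap (𝟙 (𝒳.vsp a)) x = x := CubeComplex.Hom.toMap_id _ x
    change 𝒳.toTotal (Sum.inl ⟨a, CubeComplex.Hom.toMap (𝟙 (𝒳.vsp a)) x⟩) = _
    rw [this]
  · have : CubeComplex.Hom.toMap (𝟙 (𝒳.esp e.hom)) x = x := CubeComplex.Hom.toMap_id _ x
    change 𝒳.toTotal (Sum.inr ⟨e, CubeComplex.Hom.toMap (𝟙 (𝒳.esp e.hom)) x, t⟩) = _
    rw [this]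

theorem liftPt_zero (g : Q) {a b : V} (e : a ⟶ b) (x : (𝒳.esp e).Space) :
    𝒳.liftPt ρ h g (Sum.inr ⟨⟨a, b, e⟩, (x, 0)⟩) =
      𝒳.liftPt ρ h g (Sum.inl ⟨a, CubeComplex.Hom.toMap (𝒳.minus e) x⟩) :=
  Quot.sound (Glue.zero (𝒳 := 𝒳.derived ρ h) (DerivedGraph.lift ρ e g) x)

theorem liftPt_one (g : Q) {a b : V} (e : a ⟶ b) (x : (𝒳.esp e).Space) :
    𝒳.liftPt ρ h g (Sum.inr ⟨⟨a, b, e⟩, (x, 1)⟩) =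
      𝒳.liftPt ρ h (ρ e * g) (Sum.inl ⟨b, CubeComplex.Hom.toMap (𝒳.plus e) x⟩) :=
  Quot.sound (Glue.one (𝒳 := 𝒳.derived ρ h) (DerivedGraph.lift ρ e g) x)

/-- A gluing at an initial end keeps the sheet and one at a terminal end multiplies it by `ρ e`;
these factors accumulate along a chain. Uniformity in `g` is what allows inverting and composing
them. -/
theorem exists_liftPt_eq {z z' : 𝒳.Pieces} (hz : 𝒳.toTotal z = 𝒳.toTotal z') :
    ∃ c : Q, ∀ g, 𝒳.liftPt ρ h g z = 𝒳.liftPt ρ h (c * g) z' := by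
  have := Quot.eqvGen_exact hz
  clear hz
  induction this with
  | rel _ _ h1 =>
    rcases h1 with ⟨e, x⟩ | ⟨e, x⟩
    · exact ⟨1, fun g => by rw [one_mul, liftPt_zero]⟩
    · exact ⟨ρ e, fun g => by rw [liftPt_one]⟩
  | refl => exact ⟨1, fun g => by rw [one_mul]⟩
  | symm _ _ _ ih =>
    obtain ⟨c, hc⟩ := ih
    exact ⟨c⁻¹, fun g => by rw [hc, mul_inv_cancel_left]⟩
  | trans _ _ _ _ _ ih1 ih2 =>
    obtain ⟨c, hc⟩ := ih1
    obtain ⟨d, hd⟩ := ih2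
    exact ⟨d * c, fun g => by rw [hc, hd, mul_assoc]⟩

/-- The deck transformation of the derived graph given by an element of `Q`. -/
def deckV (q : Q) (x : DerivedGraph ρ) : DerivedGraph ρ := ⟨x.base, x.sheet * q⁻¹⟩

/-- The deck transformation on the edges. -/
def deckE (q : Q) (e : Quiver.Total (DerivedGraph ρ)) : Quiver.Total (DerivedGraph ρ) :=
  ⟨deckV ρ q e.left, deckV ρ q e.right,
    ⟨e.hom.1, by
      -- Voltages multiply on the left and deck transformations on the right, so they commute; the
      -- inverse makes this a left action.
      change ρ e.hom.1 * (e.left.sheet * q⁻¹) = e.right.sheet * q⁻¹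
      rw [← mul_assoc, e.hom.2]⟩⟩

/-- The deck transformation on the pieces. -/
def deckPiece (q : Q) : (𝒳.derived ρ h).Pieces → (𝒳.derived ρ h).Pieces
  | Sum.inl x => Sum.inl ⟨deckV ρ q x.1, x.2⟩
  | Sum.inr x => Sum.inr ⟨deckE ρ q x.1, x.2⟩

theorem deckPiece_liftPiece (q g : Q) (z : 𝒳.Pieces) :
    𝒳.deckPiece ρ h q (𝒳.liftPiece ρ h g z) = 𝒳.liftPiece ρ h (g * q⁻¹) z := by
  rcases z with ⟨a, x⟩ | ⟨⟨a, b, e⟩, p⟩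
  · rfl
  · have key : ∀ (g' : Q) (h1 : ρ e * (g * q⁻¹) = g'),
        (Sum.inr ⟨⟨⟨a, g * q⁻¹⟩, ⟨b, g'⟩, ⟨e, h1⟩⟩, p⟩ : (𝒳.derived ρ h).Pieces) =
          𝒳.liftPiece ρ h (g * q⁻¹) (Sum.inr ⟨⟨a, b, e⟩, p⟩) := by
      rintro _ rfl
      rfl
    exact key (ρ e * g * q⁻¹) (mul_assoc _ _ _).symm

/-- The deck transformation on the total space. -/
def deck (q : Q) : (𝒳.derived ρ h).TotalSpace → (𝒳.derived ρ h).TotalSpace :=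
  Quot.map (𝒳.deckPiece ρ h q) (by
    rintro _ _ (⟨e, x⟩ | ⟨e, x⟩)
    · exact Glue.zero (𝒳 := 𝒳.derived ρ h) (deckE ρ q ⟨_, _, e⟩).hom x
    · exact Glue.one (𝒳 := 𝒳.derived ρ h) (deckE ρ q ⟨_, _, e⟩).hom x)

theorem deck_liftPt (q g : Q) (z : 𝒳.Pieces) :
    𝒳.deck ρ h q (𝒳.liftPt ρ h g z) = 𝒳.liftPt ρ h (g * q⁻¹) z := by
  rw [liftPt, liftPt, ← deckPiece_liftPiece]
  rfl

/-- The action of `Q` on the total space by deck transformations. -/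
@[reducible]
def deckAction : MulAction Q (𝒳.derived ρ h).TotalSpace where
  smul q x := 𝒳.deck ρ h q x
  one_smul x := by
    obtain ⟨g, z, rfl⟩ := 𝒳.exists_liftPt ρ h x
    change 𝒳.deck ρ h _ _ = _
    rw [deck_liftPt, inv_one, mul_one]
  mul_smul q r x := by
    obtain ⟨g, z, rfl⟩ := 𝒳.exists_liftPt ρ h x
    change 𝒳.deck ρ h _ _ = 𝒳.deck ρ h _ (𝒳.deck ρ h _ _)
    rw [deck_liftPt, deck_liftPt, deck_liftPt, mul_inv_rev, mul_assoc]

theorem continuous_deckPiece (q : Q) : Continuous (𝒳.deckPiece ρ h q) := by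
  refine continuous_sum_dom.2 ⟨?_, ?_⟩
  · refine continuous_inl.comp (continuous_sigma fun x => ?_)
    exact @continuous_sigmaMk _ (fun x : DerivedGraph ρ => (𝒳.vsp x.base).Space) _ (deckV ρ q x)
  · refine continuous_inr.comp (continuous_sigma fun e => ?_)
    exact @continuous_sigmaMk _ (fun e : Quiver.Total (DerivedGraph ρ) =>
      (𝒳.esp e.hom.1).Space × I) _ (deckE ρ q e)

theorem deckV_eq_self {q : Q} {x : DerivedGraph ρ} (hx : deckV ρ q x = x) : q = 1 := by
  have := congrArg DerivedGraph.sheet hx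
  simpa [deckV] using this

/-- Deck transformations preserve the coordinate along an edge, and the two halves of an edge are
disjoint, so both points lie near the same end. Then `q` fixes `x`; this works for loops as well. -/
theorem starPred_deckPiece {q : Q} {x : DerivedGraph ρ} {y : (𝒳.derived ρ h).Pieces}
    (h1 : (𝒳.derived ρ h).starPred x y)
    (h2 : (𝒳.derived ρ h).starPred x (𝒳.deckPiece ρ h q y)) : q = 1 := by
  rcases y with ⟨y, z⟩ | ⟨e, z, t⟩
  · obtain rfl : y = x := h1
    exact deckV_eq_self ρ h2
  · rcases h1 with ⟨rfl, h1⟩ | ⟨rfl, h1⟩ <;> rcases h2 with ⟨h3, h2⟩ | ⟨h3, h2⟩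
    · exact deckV_eq_self ρ h3
    · exact absurd h1 (not_lt_of_gt h2)
    · exact absurd h1 (not_lt_of_gt h2)
    · exact deckV_eq_self ρ h3

theorem edgePred_deckPiece {q : Q} {e : Quiver.Total (DerivedGraph ρ)}
    {y : (𝒳.derived ρ h).Pieces} (h1 : (𝒳.derived ρ h).edgePred e y)
    (h2 : (𝒳.derived ρ h).edgePred e (𝒳.deckPiece ρ h q y)) : q = 1 := by
  rcases y with ⟨y, z⟩ | ⟨e', z, t⟩
  · exact h1.elim
  · obtain rfl : e' = e := h1.1
    exact deckV_eq_self ρ (congrArg Quiver.Total.left h2.1)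

/-- Fibres are orbits because points with the same image differ only by a change of sheet; open
stars and edge interiors are disjoint from their nontrivial translates. -/
theorem isQuotientCoveringMap_derivedProj :
    letI := 𝒳.deckAction ρ h
    IsQuotientCoveringMap (𝒳.derivedProj ρ h).totalMap Q := by
  let := 𝒳.deckAction ρ h
  have smul_toTotal : ∀ (q : Q) (y : (𝒳.derived ρ h).Pieces),
      q • (𝒳.derived ρ h).toTotal y = (𝒳.derived ρ h).toTotal (𝒳.deckPiece ρ h q y) := fun _ _ => rfl
  have disj : ∀ P : (𝒳.derived ρ h).Pieces → Prop,
      (∀ z z', (𝒳.derived ρ h).Glue z z' → (P z ↔ P z')) →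
      (∀ q y, P y → P (𝒳.deckPiece ρ h q y) → q = 1) →
      ∀ q : Q, ((q • ·) '' (𝒳.derived ρ h).openSet P ∩ (𝒳.derived ρ h).openSet P).Nonempty →
        q = 1 := by
    rintro P hP h1 q ⟨_, ⟨y, hy, rfl⟩, hqy⟩
    obtain ⟨y, rfl⟩ := (𝒳.derived ρ h).toTotal_surjective y
    rw [mem_openSet _ hP] at hy
    change q • (𝒳.derived ρ h).toTotal y ∈ _ at hqy
    rw [smul_toTotal, mem_openSet _ hP] at hqy
    exact h1 q y hy hqy
  have hcont : Continuous (𝒳.derivedProj ρ h).totalMap := by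
    refine continuous_quot_lift _ (𝒳.isQuotientMap_toTotal.continuous.comp (Continuous.sumMap ?_ ?_))
    · refine continuous_sigma fun x => ?_
      exact (@continuous_sigmaMk _ (fun a : V => (𝒳.vsp a).Space) _ x.base).comp
        (CubeComplex.Hom.continuous_toMap (𝟙 (𝒳.vsp x.base)))
    · refine continuous_sigma fun e => ?_
      exact (@continuous_sigmaMk _ (fun e : Quiver.Total V => (𝒳.esp e.hom).Space × I) _
        ⟨e.left.base, e.right.base, e.hom.1⟩).comp
        (((CubeComplex.Hom.continuous_toMap (𝟙 (𝒳.esp e.hom.1))).comp continuous_fst).prodMk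
          continuous_snd)
  refine { toIsQuotientMap := ?_, continuous_const_smul := ?_, apply_eq_iff_mem_orbit := ?_,
           disjoint := ?_ }
  -- The lift to the sheet `1` followed by the projection is the quotient map that defines the total
  -- space downstairs.
  · refine Topology.IsQuotientMap.of_comp (𝒳.continuous_liftPt ρ h 1) hcont ?_
    have : (𝒳.derivedProj ρ h).totalMap ∘ 𝒳.liftPt ρ h 1 = 𝒳.toTotal :=
      funext (𝒳.totalMap_liftPt ρ h 1)
    rw [this]
    exact 𝒳.isQuotientMap_toTotal
  · intro q
    exact continuous_quot_lift _
      ((𝒳.derived ρ h).isQuotientMap_toTotal.continuous.comp (𝒳.continuous_deckPiece ρ h q))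
  · intro y y'
    obtain ⟨g, z, rfl⟩ := 𝒳.exists_liftPt ρ h y
    obtain ⟨g', z', rfl⟩ := 𝒳.exists_liftPt ρ h y'
    rw [totalMap_liftPt, totalMap_liftPt]
    constructor
    · intro hz
      obtain ⟨c, hc⟩ := 𝒳.exists_liftPt_eq ρ h hz
      refine ⟨(c * g)⁻¹ * g', ?_⟩
      change 𝒳.deck ρ h _ _ = _
      rw [deck_liftPt, hc]
      congr 1
      group
    · rintro ⟨q, hq⟩
      change 𝒳.deck ρ h _ _ = _ at hq
      rw [deck_liftPt] at hq
      rw [← 𝒳.totalMap_liftPt ρ h g z, ← hq, totalMap_liftPt]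
  · intro y
    obtain ⟨y, rfl⟩ := (𝒳.derived ρ h).toTotal_surjective y
    rcases (𝒳.derived ρ h).star_or_edge y with ⟨a, ha⟩ | ⟨e, he⟩
    · exact ⟨_, ((𝒳.derived ρ h).isOpen_star a).mem_nhds ⟨y, rfl, ha⟩,
        disj _ ((𝒳.derived ρ h).starPred_glue a) fun q y => 𝒳.starPred_deckPiece ρ h⟩
    · exact ⟨_, ((𝒳.derived ρ h).isOpen_edge e).mem_nhds ⟨y, rfl, he⟩,
        disj _ ((𝒳.derived ρ h).edgePred_glue e) fun q y => 𝒳.edgePred_deckPiece ρ h⟩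

theorem isFiniteCover_derivedProj [Finite Q] : (𝒳.derivedProj ρ h).IsFiniteCover := by
  let := 𝒳.deckAction ρ h
  have hq : IsQuotientCoveringMap (𝒳.derivedProj ρ h).totalMap Q :=
    𝒳.isQuotientCoveringMap_derivedProj ρ h
  refine ⟨hq.isCoveringMap, Nat.card Q, Nat.card_pos.ne', fun x => ?_⟩
  obtain ⟨y, hy⟩ := hq.surjective x
  exact Nat.card_congr (hq.fiberEquivGroup ⟨y, hy⟩)

end Derived

end GraphOfCubeComplexes

/-! ### Compact cube complexes -/

namespace FaceMap

instance (m n : ℕ) : Finite (FaceMap m n) :=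
  Finite.of_injective FaceMap.coord fun _ _ h => FaceMap.ext h

/-- The midpoint of `[0,1]`. -/
noncomputable def half : I := ⟨1 / 2, by norm_num, by norm_num⟩

theorem symm_half : unitInterval.symm half = half := by
  ext
  simp only [half, unitInterval.coe_symm_eq]
  norm_num

theorem half_ne_zero : half ≠ 0 := by
  intro h
  have := congrArg Subtype.val h
  norm_num [half] at this

theorem half_ne_one : half ≠ 1 := by
  intro h
  have := congrArg Subtype.val h
  norm_num [half] at this

variable {k m n : ℕ}

theorem le (f : FaceMap m n) : m ≤ n := by
  choose j hj _ using f.existsUnique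
  have hinj : Function.Injective j := by
    intro i i' h
    obtain ⟨r, hr⟩ := hj i
    obtain ⟨r', hr'⟩ := hj i'
    rw [h, hr'] at hr
    simp only [Sum.inr.injEq, Prod.mk.injEq] at hr
    exact hr.1.symm
  simpa using Fintype.card_le_of_injective j hinj

theorem toFun_injective (f : FaceMap m n) : Function.Injective f.toFun := by
  intro x y h
  funext i
  obtain ⟨j, ⟨r, hr⟩, -⟩ := f.existsUnique i
  have := congrFun h j
  simp only [toFun, hr] at this
  cases r
  · simpa using this
  · simpa using this

/-- The center of a cube. -/
noncomputable def center (n : ℕ) : Fin n → I := fun _ => half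

/-- Subcubes of `[0,1]^n` whose centers lie in the subcube `f` factor through `f`. -/
theorem exists_comp_eq (f : FaceMap m n) (g : FaceMap k n) (x : Fin m → I)
    (h : g.toFun (center k) = f.toFun x) :
    ∃ g' : FaceMap k m, f.comp g' = g ∧ g'.toFun (center k) = x := by
  -- The center has all coordinates `1/2`, so where `f` is constantly `0` or `1` the map `g` must be
  -- constant too.
  have hinl : ∀ j b, f.coord j = Sum.inl b → g.coord j = Sum.inl b := by
    intro j b hj
    have := congrFun h j
    rcases hg : g.coord j with b' | ⟨i, r⟩
    · simp only [toFun, hj, hg] at this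
      cases b <;> cases b' <;> simp_all
    · simp only [toFun, hj, hg, center, symm_half] at this
      cases b <;> cases r <;> simp_all [half_ne_zero, half_ne_one]
  choose j hj huniq using f.existsUnique
  choose r hr using hj
  -- Read `g` in the coordinate `j i` that carries the `i`-th coordinate under `f`, undoing the
  -- reflection `r i`.
  let g' : FaceMap k m :=
    { coord := fun i => match g.coord (j i) with
        | Sum.inl b => Sum.inl (xor b (r i))
        | Sum.inr (l, s) => Sum.inr (l, xor s (r i))
      existsUnique := fun l => by
        obtain ⟨j₀, ⟨s, hs⟩, hu⟩ := g.existsUnique l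
        rcases hf : f.coord j₀ with b | ⟨i, t⟩
        · rw [hinl _ _ hf] at hs
          cases hs
        · have hji : j₀ = j i := huniq i j₀ ⟨t, hf⟩
          refine ⟨i, ⟨xor s (r i), by simp only [← hji, hs]⟩, ?_⟩
          rintro i' ⟨s', hs'⟩
          rcases hg : g.coord (j i') with b | ⟨l', s''⟩
          · simp [hg] at hs'
          · simp only [hg, Sum.inr.injEq, Prod.mk.injEq] at hs'
            have h1 : j i' = j₀ := hu (j i') ⟨s'', by rw [hg, hs'.1]⟩
            have h2 := hr i'
            rw [h1, hji, hr i] at h2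
            simp only [Sum.inr.injEq, Prod.mk.injEq] at h2
            exact h2.1.symm }
  have hcomp : f.comp g' = g := by
    ext1
    funext j₀
    rcases hf : f.coord j₀ with b | ⟨i, t⟩
    · simp only [comp, hf, hinl _ _ hf]
    · have hji : j₀ = j i := huniq i j₀ ⟨t, hf⟩
      have ht : t = r i := by
        have := hr i
        rw [← hji, hf] at this
        simpa using this
      rcases hg : g.coord (j i) with b | ⟨l, s⟩
      · simp [comp, g', hg, hji, hr]
      · simp [comp, g', hg, hji, hr]
  refine ⟨g', hcomp, f.toFun_injective ?_⟩
  rw [← toFun_comp, hcomp, h]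

/-- The points all of whose coordinates are `0`, `1/2` or `1`. -/
def IsHalfIntegral (x : Fin n → I) : Prop := ∀ i, x i = 0 ∨ x i = half ∨ x i = 1

/-- The set `{0, 1/2, 1}` is stable under `t ↦ 1 - t` and contains the constant coordinates, so
half-integrality is compatible with gluing. -/
theorem isHalfIntegral_toFun (f : FaceMap m n) (x : Fin m → I) :
    IsHalfIntegral (f.toFun x) ↔ IsHalfIntegral x := by
  have symm_iff : ∀ t : I, (unitInterval.symm t = 0 ∨ unitInterval.symm t = half ∨
      unitInterval.symm t = 1) ↔ (t = 0 ∨ t = half ∨ t = 1) := by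
    intro t
    have h1 : unitInterval.symm t = half ↔ t = half := by
      rw [← unitInterval.symm_inj, unitInterval.symm_symm, symm_half]
    rw [unitInterval.symm_eq_zero, h1, unitInterval.symm_eq_one]
    tauto
  constructor
  · intro h i
    obtain ⟨j, ⟨r, hr⟩, -⟩ := f.existsUnique i
    have := h j
    simp only [toFun, hr] at this
    cases r
    · simpa using this
    · exact (symm_iff _).1 this
  · intro h j
    rcases hj : f.coord j with b | ⟨i, r⟩
    · cases b <;> simp [toFun, hj]
    · cases r
      · simpa [toFun, hj] using h i
      · have h1 : f.toFun x j = unitInterval.symm (x i) := by simp [toFun, hj]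
        rw [h1]
        exact (symm_iff _).2 (h i)

theorem finite_isHalfIntegral (n : ℕ) : {x : Fin n → I | IsHalfIntegral x}.Finite := by
  have : {x : Fin n → I | IsHalfIntegral x} = Set.univ.pi fun _ => {0, half, 1} := by
    ext x
    simp [IsHalfIntegral, Set.mem_pi]
  rw [this]
  exact Set.Finite.pi fun _ => Set.toFinite _

end FaceMap

namespace CubeComplex

variable (X : CubeComplex.{w})

/-- The center of a cube, as a point of the complex. -/
noncomputable def centerPt (c : Σ n, X.cube n) : X.Space :=
  Quot.mk _ ⟨c, FaceMap.center c.1⟩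

/-- The half-integral points. -/
def halfIntegralPred (p : X.Pt) : Prop := FaceMap.IsHalfIntegral p.2

theorem halfIntegralPred_glue (p q : X.Pt) (h : X.Glue p q) :
    X.halfIntegralPred p ↔ X.halfIntegralPred q := by
  rcases h with ⟨f, c, x⟩
  exact (f.isHalfIntegral_toFun x).symm

/-- Every set of centers pulls back in each cube to half-integral points, a finite and hence closed
set. So the set of centers is closed and discrete in a compact space. -/
theorem finite_range_centerPt [CompactSpace X.Space] : (Set.range X.centerPt).Finite := by
  have hclosed : ∀ S : Set X.Space, S ⊆ Set.range X.centerPt → IsClosed S := by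
    intro S hS
    refine (isQuotientMap_quot_mk (r := X.Glue)).isClosed_preimage.1 (isClosed_sigma_iff.2 ?_)
    intro c
    refine ((FaceMap.finite_isHalfIntegral c.1).subset ?_).isClosed
    intro x hx
    obtain ⟨d, hd⟩ := hS hx
    have key := congrArg (Quot.lift X.halfIntegralPred
      fun p q h => propext (X.halfIntegralPred_glue p q h)) hd
    exact key.mp fun i => Or.inr (Or.inl rfl)
  have : DiscreteTopology (Set.range X.centerPt) := by
    refine discreteTopology_iff_forall_isClosed.2 fun t => ?_
    rw [← Set.preimage_image_eq t Subtype.val_injective]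
    exact (hclosed _ (Subtype.coe_image_subset _ t)).preimage continuous_subtype_val
  have : CompactSpace (Set.range X.centerPt) :=
    isCompact_iff_compactSpace.1 (hclosed _ subset_rfl).isCompact
  have : Finite (Set.range X.centerPt) := finite_of_compact_of_discrete
  exact Set.toFinite _

theorem exists_face_of_centerPt_eq {c d : Σ n, X.cube n} (h : X.centerPt c = X.centerPt d) :
    ∃ g : FaceMap d.1 c.1, X.face g c.2 = d.2 := by
  -- "`d` is a subcube centered at this point" is invariant under gluing, so it passes from the
  -- center of `d` to the center of `c`.
  let P : X.Pt → Prop := fun p => ∃ g : FaceMap d.1 p.1.1,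
    g.toFun (FaceMap.center d.1) = p.2 ∧ X.face g p.1.2 = d.2
  have hP : ∀ p q, X.Glue p q → P p = P q := by
    rintro _ _ ⟨f, c, x⟩
    refine propext ⟨?_, ?_⟩
    · rintro ⟨g, hg, hd⟩
      refine ⟨f.comp g, ?_, ?_⟩
      · rw [FaceMap.toFun_comp, hg]
      · rw [X.face_comp, hd]
    · rintro ⟨g, hg, hd⟩
      obtain ⟨g', rfl, hx⟩ := f.exists_comp_eq g x hg
      exact ⟨g', hx, by rw [← X.face_comp, hd]⟩
  have key : P ⟨c, _⟩ = P ⟨d, _⟩ := congrArg (Quot.lift P hP) h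
  obtain ⟨g, -, hg⟩ := key.mpr ⟨FaceMap.id _, FaceMap.toFun_id _ _, X.face_id _⟩
  exact ⟨g, hg⟩

/-- There are finitely many centers, and every cube with the same center as `c` is a face of `c`, of
which there are finitely many. -/
theorem finite_cubes [CompactSpace X.Space] : Finite (Σ n, X.cube n) := by
  rw [← Set.finite_univ_iff]
  refine Set.Finite.of_finite_fibers X.centerPt ?_ fun x hx => ?_
  · rw [Set.image_univ]
    exact X.finite_range_centerPt
  · obtain ⟨c, -, rfl⟩ := hx
    let F : (Σ m : Fin (c.1 + 1), FaceMap m c.1) → Σ n, X.cube n := fun g =>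
      ⟨g.1, X.face g.2 c.2⟩
    refine (Set.finite_range F).subset ?_
    rintro ⟨m, d⟩ ⟨-, hd⟩
    obtain ⟨g, hg⟩ := X.exists_face_of_centerPt_eq (c := c) (d := ⟨m, d⟩) hd.symm
    exact ⟨⟨⟨m, Nat.lt_succ_of_le g.le⟩, g⟩, by simp only [F]; rw [hg]⟩

theorem finite_aut [CompactSpace X.Space] : Finite (Aut X) := by
  have := X.finite_cubes
  refine Finite.of_injective (β := (Σ n, X.cube n) → (Σ n, X.cube n))
    (fun f c => ⟨c.1, Hom.app f.hom c.2⟩) fun f g h => ?_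
  refine Aut.ext (Hom.ext ?_)
  funext n c
  have := congrFun h ⟨n, c⟩
  simpa using this

end CubeComplex

/-! ### Constant vertex spaces -/

namespace GraphOfCubeComplexes

variable {V : Type u} [Quiver.{v} V] {𝒳 : GraphOfCubeComplexes.{w} V}

/-- A graph of cube complexes with trivial monodromy has constant vertex spaces. -/
theorem LocallyConstant.hasConstantVertexSpaces (θ : 𝒳.LocallyConstant) (a : V) (h : θ.monodromyGroup a = ⊥) :
    𝒳.HasConstantVertexSpaces := by
  have key := exists_trivialization 𝒳.vsp θ.iso 𝒳.connected a
  obtain ⟨ψ, hψ⟩ := key h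
  refine ⟨𝒳.vsp a, ψ, 𝒳.vsp_npc a, 𝒳.vsp_connected a, fun b c e => ?_⟩
  rw [← hψ e, Iso.trans_hom, ← Category.assoc, θ.minus_iso]

/-- A graph of cube complexes with compact vertex spaces has a finite cover with constant vertex
spaces. -/
theorem LocallyConstant.exists_isFiniteCover (θ : 𝒳.LocallyConstant)
    (hcpt : ∀ a : V, CompactSpace (𝒳.vsp a).Space) :
    ∃ (V' : Type u) (_ : Quiver.{v} V') (𝒳' : GraphOfCubeComplexes.{w} V') (q : Hom 𝒳' 𝒳),
      q.IsFiniteCover ∧ 𝒳'.HasConstantVertexSpaces := by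
  obtain ⟨a⟩ := 𝒳.connected.1
  have := hcpt a
  have := (𝒳.vsp a).finite_aut
  -- Arbitrary paths suffice: the covering is built from the derived graph without a spanning tree.
  obtain ⟨Q, _, _, ρ, -, hc, ψ, hψ⟩ := exists_derived_trivialization 𝒳.vsp θ.iso
    fun b => (𝒳.connected.nonempty_hom a b).some
  refine ⟨DerivedGraph ρ, inferInstance, 𝒳.derived ρ hc, 𝒳.derivedProj ρ hc,
    𝒳.isFiniteCover_derivedProj ρ hc, 𝒳.vsp a, ψ, 𝒳.vsp_npc a, 𝒳.vsp_connected a,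
    fun x y e => ?_⟩
  change 𝒳.minus e.1 ≫ (ψ x).hom = 𝒳.plus e.1 ≫ (ψ y).hom
  rw [← hψ e, Iso.trans_hom, ← Category.assoc, θ.minus_iso]

end GraphOfCubeComplexes

theorem mainTheorem6
    {V : Type u} [Quiver.{v} V] (𝒢 : GraphOfGroups.{w} V) (Θ : 𝒢.LocallyConstant)
    (T : WideSubquiver V) (hT : IsSpanningTree T)
    {G : Type*} [Group G] (splitG : G ≃* 𝒢.Pi1 T)
    {W : Type u'} [Quiver.{v'} W] (𝒳 : GraphOfCubeComplexes.{w'} W) (θ : 𝒳.LocallyConstant) :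
    -- (1) trivial monodromy implies constant
    (∀ a : V, Θ.monodromyGroup a = ⊥ → 𝒢.HasConstantVertexGroups) ∧
    (∀ a : W, θ.monodromyGroup a = ⊥ → 𝒳.HasConstantVertexSpaces) ∧
    -- (2) finite monodromy: a finite index subgroup, with its induced splitting
    (∀ a : V, Finite (Θ.monodromyGroup a) →
      ∃ G' : Subgroup G, G'.FiniteIndex ∧
        ∃ (V' : Type u) (_ : Quiver.{v} V') (𝒢' : GraphOfGroups.{w} V')
          (T' : WideSubquiver V') (_ : IsSpanningTree T') (splitG' : G' ≃* 𝒢'.Pi1 T'),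
          𝒢'.HasConstantVertexGroups ∧
          𝒢.IsInducedSplitting T 𝒢' T'
            ((splitG.toMonoidHom.comp G'.subtype).comp splitG'.symm.toMonoidHom)) ∧
    -- (3) compact vertex spaces: a finite-sheeted cover, with its induced splitting
    ((∀ a : W, CompactSpace (𝒳.vsp a).Space) →
      ∃ (W' : Type u') (_ : Quiver.{v'} W') (𝒳' : GraphOfCubeComplexes.{w'} W')
        (q : GraphOfCubeComplexes.Hom 𝒳' 𝒳),
        q.IsFiniteCover ∧ 𝒳'.HasConstantVertexSpaces) :=
  ⟨Θ.hasConstantVertexGroups, θ.hasConstantVertexSpaces,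
    Θ.exists_finiteIndex T hT splitG, θ.exists_isFiniteCover⟩
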